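/- **Theorem 3.** Let $k\ge 4$. A smooth vector field $V=\xi(x,y)\partial_x+\eta(x,y)\partial_y$ on an open set $U$ of the $(x,y)$-plane is a *Lie point symmetry* of an ODE $\Delta(x,y,y',\dots,y^{(k)})=0$ (considered where $y'\ne 0$) if its prolongation $V^{(k)}=\xi\partial_x+\sum_{j=0}^{k}\eta^{(j)}\partial_{y^{(j)}}$, with $\eta^{(0)}=\eta$ and $\eta^{(j+1)}=D_x\eta^{(j)}-y^{(j+1)}D_x\xi$, satisfies $V^{(k)}\Delta=0$ at all jets over $U$ with $y'\neq 0$ and $\Delta=0$. There are real numbers $a_1,\dots,a_{k-2}$, and they are unique, such that the equation $$E_k:=y^{(k)}-\sum_{q=1}^{k-3}\frac{a_q\,(y'')^q\,y^{(k-q)}\,(y')^{k-2-q}}{(y')^{k-2}}-a_{k-2}\frac{(y'')^{k-1}}{(y')^{k-2}}=0$$ admits $x\partial_x$, $\partial_x$, $x^2\partial_x$ as Lie point symmetries on the whole plane (that is, it is $\mathfrak{sl}(2,\mathbb R)$-invariant). With these coefficients, consider the equation $$E_k+\left(y+\frac{2y'y'''-3(y'')^2}{(y')^4}\right)(y')^k=0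 .\qquad(*)$$ It is of order $k$ and nonlinear: on $y'\ne0$ it is not equivalent to any equation $b(x)+\sum_{j=0}^k c_j(x)y^{(j)}=0$. For every nonempty connected open set $U\subseteq\mathbb R^2$, the set of all Lie point symmetries of $(*)$ on $U$ is a Lie subalgebra of the Lie algebra of smooth vector fields on $U$, and this Lie algebra is isomorphic to $\mathfrak{sl}(2,\mathbb R)$. -/

import Mathlib

open scoped ContDiff

noncomputable section

namespace PointSymmetry

/-! ### Smooth vector fields on an open subset of the plane -/

/-- Smooth vector fields `ξ ∂_x + η ∂_y` on an open set `U` of the `(x, y)`-plane, with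
`V (x, y) = (ξ (x, y), η (x, y))`. So that two fields are equal exactly when they agree on `U`,
each field is represented by its extension by zero to the plane. -/
def SmoothVF (U : TopologicalSpace.Opens (ℝ × ℝ)) : Submodule ℝ (ℝ × ℝ → ℝ × ℝ) where
  carrier := {V | ContDiffOn ℝ ∞ V U ∧ ∀ p ∉ U, V p = 0}
  add_mem' := by
    rintro V W ⟨hV, hV0⟩ ⟨hW, hW0⟩
    exact ⟨hV.add hW, fun p hp => by simp [hV0 p hp, hW0 p hp]⟩
  zero_mem' := ⟨contDiffOn_const, fun _ _ => rfl⟩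
  smul_mem' := by
    rintro c V ⟨hV, hV0⟩
    exact ⟨contDiffOn_const.smul hV, fun p hp => by simp [hV0 p hp]⟩

namespace SmoothVF

variable {U : TopologicalSpace.Opens (ℝ × ℝ)}

theorem smoothAt (V : SmoothVF U) {p : ℝ × ℝ} (hp : p ∈ U) : ContDiffAt ℝ ∞ V.1 p :=
  V.2.1.contDiffAt (U.isOpen.mem_nhds hp)

theorem diffAt (V : SmoothVF U) {p : ℝ × ℝ} (hp : p ∈ U) :
    DifferentiableAt ℝ V.1 p :=
  (smoothAt V hp).differentiableAt (by simp)

/-- The Lie bracket of vector fields on `U` (extended by zero outside `U`). -/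
def bracket (V W : SmoothVF U) : SmoothVF U :=
  ⟨(U : Set (ℝ × ℝ)).indicator (VectorField.lieBracket ℝ V.1 W.1), by
    constructor
    · intro p hp
      have h : ContDiffAt ℝ ∞ (VectorField.lieBracket ℝ V.1 W.1) p :=
        (smoothAt V hp).lieBracket_vectorField (smoothAt W hp) (by simp)
      exact h.contDiffWithinAt.congr
        (fun q hq => Set.indicator_of_mem hq _) (Set.indicator_of_mem hp _)
    · intro p hp
      exact Set.indicator_of_notMem hp _⟩

instance : Bracket (SmoothVF U) (SmoothVF U) := ⟨bracket⟩

theorem bracket_apply (V W : SmoothVF U) {p : ℝ × ℝ} (hp : p ∈ U) :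
    (⁅V, W⁆ : SmoothVF U).1 p = VectorField.lieBracket ℝ V.1 W.1 p :=
  Set.indicator_of_mem (s := (U : Set (ℝ × ℝ))) hp _

theorem bracket_eventuallyEq (V W : SmoothVF U) {p : ℝ × ℝ} (hp : p ∈ U) :
    (⁅V, W⁆ : SmoothVF U).1 =ᶠ[nhds p] VectorField.lieBracket ℝ V.1 W.1 := by
  filter_upwards [U.isOpen.mem_nhds hp] with q hq using bracket_apply V W hq

theorem ext_on {V W : SmoothVF U} (h : ∀ p ∈ U, V.1 p = W.1 p) : V = W := by
  apply Subtype.ext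
  funext p
  by_cases hp : p ∈ U
  · exact h p hp
  · rw [V.2.2 p hp, W.2.2 p hp]

theorem bracket_add_right (V W W' : SmoothVF U) : ⁅V, W + W'⁆ = ⁅V, W⁆ + ⁅V, W'⁆ := by
  refine ext_on fun p hp => ?_
  have h1 := bracket_apply V (W + W') hp
  have h2 := VectorField.lieBracket_add_right (V := V.1)
    (diffAt W hp) (diffAt W' hp)
  change _ = (⁅V, W⁆ : SmoothVF U).1 p + (⁅V, W'⁆ : SmoothVF U).1 p
  rw [h1, bracket_apply V W hp, bracket_apply V W' hp]
  exact h2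

theorem bracket_smul_right (c : ℝ) (V W : SmoothVF U) : ⁅V, c • W⁆ = c • ⁅V, W⁆ := by
  refine ext_on fun p hp => ?_
  have h1 := bracket_apply V (c • W) hp
  have h2 := VectorField.lieBracket_const_smul_right (V := V.1) (c := c) (diffAt W hp)
  change _ = c • (⁅V, W⁆ : SmoothVF U).1 p
  rw [h1, bracket_apply V W hp]
  exact h2

theorem bracket_swap (V W : SmoothVF U) : ⁅V, W⁆ = -⁅W, V⁆ := by
  refine ext_on fun p hp => ?_
  change _ = -(⁅W, V⁆ : SmoothVF U).1 p
  rw [bracket_apply V W hp, bracket_apply W V hp]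
  exact VectorField.lieBracket_swap

theorem bracket_leibniz (V W Z : SmoothVF U) : ⁅V, ⁅W, Z⁆⁆ = ⁅⁅V, W⁆, Z⁆ + ⁅W, ⁅V, Z⁆⁆ := by
  refine ext_on fun p hp => ?_
  change _ = (⁅⁅V, W⁆, Z⁆ : SmoothVF U).1 p + (⁅W, ⁅V, Z⁆⁆ : SmoothVF U).1 p
  rw [bracket_apply _ _ hp, bracket_apply _ _ hp, bracket_apply _ _ hp,
    Filter.EventuallyEq.lieBracket_vectorField_eq Filter.EventuallyEq.rfl
      (bracket_eventuallyEq W Z hp),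
    Filter.EventuallyEq.lieBracket_vectorField_eq (bracket_eventuallyEq V W hp)
      Filter.EventuallyEq.rfl,
    Filter.EventuallyEq.lieBracket_vectorField_eq Filter.EventuallyEq.rfl
      (bracket_eventuallyEq V Z hp)]
  exact VectorField.leibniz_identity_lieBracket (n := ∞)
    (by rw [minSmoothness_of_isRCLikeNormedField]; exact WithTop.coe_le_coe.2 le_top)
    (smoothAt V hp) (smoothAt W hp) (smoothAt Z hp)

instance : LieRing (SmoothVF U) where
  add_lie V V' W := by
    rw [bracket_swap, bracket_add_right, neg_add, ← bracket_swap, ← bracket_swap]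
  lie_add := bracket_add_right
  lie_self V := by
    refine ext_on fun p hp => ?_
    rw [bracket_apply V V hp, VectorField.lieBracket_self]
    rfl
  leibniz_lie := bracket_leibniz

instance : LieAlgebra ℝ (SmoothVF U) where
  lie_smul := bracket_smul_right

end SmoothVF

/-! ### Jets, prolongation and infinitesimal point symmetries -/

/-- Jet coordinates `(x, y, y', y'', …)`: for `p : Jet`, `p.1` is `x` and `p.2 j` is `y^{(j)}`.
All functions on jets used below involve finitely many of these coordinates only. -/
abbrev Jet : Type := ℝ × (ℕ → ℝ)

/-- The total derivative `D F = ∂F/∂x + ∑_j y^{(j+1)} ∂F/∂y^{(j)}`: the derivative of `F` in the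
direction `(1, y', y'', …)`. -/
def totalDeriv (F : Jet → ℝ) : Jet → ℝ :=
  fun p => lineDeriv ℝ F p (1, fun j => p.2 (j + 1))

/-- The coefficient `η^{(j)}` of `∂/∂y^{(j)}` in the prolongation of `V = ξ ∂_x + η ∂_y`:
`η^{(0)} = η` and `η^{(j+1)} = D η^{(j)} - y^{(j+1)} D ξ`. -/
def prolongCoeff (V : ℝ × ℝ → ℝ × ℝ) : ℕ → Jet → ℝ
  | 0 => fun p => (V (p.1, p.2 0)).2
  | j + 1 => fun p => totalDeriv (prolongCoeff V j) p
      - p.2 (j + 1) * totalDeriv (fun q => (V (q.1, q.2 0)).1) p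

/-- The prolonged vector field `ξ ∂_x + ∑_j η^{(j)} ∂/∂y^{(j)}` applied to the function `Δ` on
jets. If `Δ` involves only `x, y, …, y^{(k)}`, this is the `k`-th prolongation applied to `Δ`. -/
def prolong (V : ℝ × ℝ → ℝ × ℝ) (Δ : Jet → ℝ) (p : Jet) : ℝ :=
  lineDeriv ℝ Δ p ((V (p.1, p.2 0)).1, fun j => prolongCoeff V j p)

/-- `V` is a Lie point symmetry over `U` of the equation `Δ = 0`, considered where `y' ≠ 0`:
the prolongation of `V` annihilates `Δ` at every jet over `U` with `y' ≠ 0` and `Δ = 0`. -/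
def IsPointSymmetry (U : Set (ℝ × ℝ)) (Δ : Jet → ℝ) (V : ℝ × ℝ → ℝ × ℝ) : Prop :=
  ∀ p : Jet, (p.1, p.2 0) ∈ U → p.2 1 ≠ 0 → Δ p = 0 → prolong V Δ p = 0

/-- `L` is the full algebra of Lie point symmetries over `U` of the equation `Δ = 0`. -/
def IsFullSymmetryAlgebra (U : TopologicalSpace.Opens (ℝ × ℝ)) (Δ : Jet → ℝ)
    (L : LieSubalgebra ℝ (SmoothVF U)) : Prop :=
  ∀ V : SmoothVF U, V ∈ L ↔ IsPointSymmetry U Δ V.1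

/-! ### Order and nonlinearity -/

/-- On the region `y' ≠ 0`, `Δ` involves only `x, y, …, y^{(k)}`, and it does
depend on `y^{(k)}`. -/
def HasOrder (k : ℕ) (Δ : Jet → ℝ) : Prop :=
  (∀ p q : Jet, p.2 1 ≠ 0 → p.1 = q.1 → (∀ j ≤ k, p.2 j = q.2 j) → Δ p = Δ q) ∧
  ∃ p q : Jet, p.2 1 ≠ 0 ∧ q.2 1 ≠ 0 ∧ p.1 = q.1 ∧ (∀ j ≠ k, p.2 j = q.2 j) ∧ Δ p ≠ Δ q

/-- On the region `y' ≠ 0`, the equation `Δ = 0` is equivalent to a linear (possibly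
inhomogeneous) equation `b(x) + ∑_{j ≤ k} c_j(x) y^{(j)} = 0`. -/
def IsLinearODE (k : ℕ) (Δ : Jet → ℝ) : Prop :=
  ∃ (b : ℝ → ℝ) (c : ℕ → ℝ → ℝ), ∀ p : Jet, p.2 1 ≠ 0 →
    (Δ p = 0 ↔ b p.1 + ∑ j ∈ Finset.range (k + 1), c j p.1 * p.2 j = 0)

/-! ### The equations -/

/-- Left side of the equation
`y^{(k)} - ∑_{q=1}^{k-3} a_q (y'')^q y^{(k-q)} (y')^{k-2-q} / (y')^{k-2}
  - a_{k-2} (y'')^{k-1} / (y')^{k-2} = 0`. Only `a 1, …, a (k - 2)` matter. -/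
def baseLHS (k : ℕ) (a : ℕ → ℝ) (p : Jet) : ℝ :=
  p.2 k
    - ∑ q ∈ Finset.Icc 1 (k - 3),
        a q * p.2 2 ^ q * p.2 (k - q) * p.2 1 ^ (k - 2 - q) / p.2 1 ^ (k - 2)
    - a (k - 2) * (p.2 2 ^ (k - 1) / p.2 1 ^ (k - 2))

/-- Left side of the modified equation: `baseLHS` plus
`(y + (2 y' y''' - 3 (y'')^2) / (y')^4) (y')^k`. -/
def modifiedLHS (k : ℕ) (a : ℕ → ℝ) (p : Jet) : ℝ :=
  baseLHS k a p
    + (p.2 0 + (2 * p.2 1 * p.2 3 - 3 * p.2 2 ^ 2) / p.2 1 ^ 4) * p.2 1 ^ k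

/-- The equation `Δ = 0` is invariant under `sl(2, ℝ)` realized by the vector fields
`x ∂_x`, `∂_x`, `x² ∂_x`. -/
def IsSl2Invariant (Δ : Jet → ℝ) : Prop :=
  IsPointSymmetry Set.univ Δ (fun z => (z.1, 0)) ∧
  IsPointSymmetry Set.univ Δ (fun _ => (1, 0)) ∧
  IsPointSymmetry Set.univ Δ (fun z => (z.1 ^ 2, 0))

end PointSymmetry

end

/-! Put k = n + 4 and r = y''/y', and write E_k as minus the sum of b_q r^q y^{(k-q)} over 0 ≤ q ≤
k-2, with b_0 = -1. For ξ(x)∂_x with ξ quadratic, η^{(j)} = -(j ξ' y^{(j)} + j(j-1)/2 ξ''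
y^{(j-1)}). Hence the prolongation maps E_k to -k ξ' E_k plus ξ''/2 times a combination of the
monomials r^q y^{(k-1-q)} (`baseDir_quadField`). These are independent, so invariance means that
each coefficient `defect n b q` vanishes. This is a recursion from b_0 whose leading factors are
nonzero, which gives existence and uniqueness of the coefficients (`defect_eq_zero`,
`eq_of_defect_eq_zero`).

In (*) the fraction added to y is twice the Schwarzian of y divided by (y')^2, that is, -2 times the
Schwarzian of the inverse function x(y). It is invariant under Möbius maps of x, and (y')^k has the
same weight -k ξ' as E_k, so the three fields survive.

Conversely, let X∂_x + Y∂_y be a symmetry of (*). On the jets with Δ = 0, the coefficient of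
y^{(k-1)} gives X_y = Y_x = 0, and Y_yy = 0 for k > 4 or Y_yy = Y_y for k = 4 (`determining_sub`,
`py_fst_px_snd_eq_zero`, `py_py_snd_eq`). Jets with y'' = … = y^{(k-1)} = 0 then give X_xxx = 0 and
a linear relation for Y; because of the bare y in (*), it contains Y itself and forces Y = 0
(`determining_line`, `determining_solution`). Connectedness turns X_xxx = X_y = 0 into one quadratic
polynomial on all of U (`exists_quad`), and these fields form a copy of sl(2, ℝ) (`sl2Hom`). -/

noncomputable section

namespace PointSymmetry

/-! ### Partial derivatives in the plane -/

/-- The partial derivative `∂f/∂x` of a function on the plane. -/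
def px (f : ℝ × ℝ → ℝ) (z : ℝ × ℝ) : ℝ := fderiv ℝ f z (1, 0)

/-- The partial derivative `∂f/∂y` of a function on the plane. -/
def py (f : ℝ × ℝ → ℝ) (z : ℝ × ℝ) : ℝ := fderiv ℝ f z (0, 1)

theorem fderiv_apply_eq (f : ℝ × ℝ → ℝ) (z : ℝ × ℝ) (a b : ℝ) :
    fderiv ℝ f z (a, b) = a * px f z + b * py f z := by
  have h : ((a, b) : ℝ × ℝ) = a • ((1, 0) : ℝ × ℝ) + b • ((0, 1) : ℝ × ℝ) := by simp
  rw [h, map_add, map_smul, map_smul]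
  rfl

theorem contDiffOn_fderiv_apply {U : Set (ℝ × ℝ)} (hU : IsOpen U) {f : ℝ × ℝ → ℝ}
    (hf : ContDiffOn ℝ ∞ f U) (v : ℝ × ℝ) : ContDiffOn ℝ ∞ (fun z => fderiv ℝ f z v) U :=
  (hf.fderiv_of_isOpen hU (by simp)).clm_apply contDiffOn_const

theorem contDiffOn_px {U : Set (ℝ × ℝ)} (hU : IsOpen U) {f : ℝ × ℝ → ℝ}
    (hf : ContDiffOn ℝ ∞ f U) : ContDiffOn ℝ ∞ (px f) U := contDiffOn_fderiv_apply hU hf _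

theorem contDiffOn_py {U : Set (ℝ × ℝ)} (hU : IsOpen U) {f : ℝ × ℝ → ℝ}
    (hf : ContDiffOn ℝ ∞ f U) : ContDiffOn ℝ ∞ (py f) U := contDiffOn_fderiv_apply hU hf _

theorem py_px {U : Set (ℝ × ℝ)} (hU : IsOpen U) {f : ℝ × ℝ → ℝ}
    (hf : ContDiffOn ℝ ∞ f U) {z : ℝ × ℝ} (hz : z ∈ U) : py (px f) z = px (py f) z := by
  have h1 : ContDiffAt ℝ ∞ f z := hf.contDiffAt (hU.mem_nhds hz)
  have h2 : DifferentiableAt ℝ (fderiv ℝ f) z :=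
    (h1.fderiv_right (m := ∞) (by simp)).differentiableAt (by simp)
  have hs : IsSymmSndFDerivAt ℝ f z := h1.isSymmSndFDerivAt (by
    rw [minSmoothness_of_isRCLikeNormedField]; exact WithTop.coe_le_coe.2 le_top)
  have key : ∀ v w : ℝ × ℝ, fderiv ℝ (fun z => fderiv ℝ f z v) z w
      = fderiv ℝ (fderiv ℝ f) z w v := by
    intro v w
    rw [fderiv_clm_apply h2 (differentiableAt_const _)]
    simp
  change fderiv ℝ (fun z => fderiv ℝ f z (1, 0)) z (0, 1)
    = fderiv ℝ (fun z => fderiv ℝ f z (0, 1)) z (1, 0)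
  rw [key, key, hs.eq]

theorem px_py_congr {U : Set (ℝ × ℝ)} (hU : IsOpen U) {f g : ℝ × ℝ → ℝ}
    (h : ∀ z ∈ U, f z = g z) {z : ℝ × ℝ} (hz : z ∈ U) : px f z = px g z ∧ py f z = py g z := by
  have : f =ᶠ[nhds z] g := by
    filter_upwards [hU.mem_nhds hz] with w hw using h w hw
  constructor <;> simp only [px, py, this.fderiv_eq]

theorem exists_const_of_px_py {U : Set (ℝ × ℝ)} (hU : IsOpen U) (hc : IsPreconnected U)
    {f : ℝ × ℝ → ℝ} (hf : ContDiffOn ℝ ∞ f U) (hx : ∀ z ∈ U, px f z = 0)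
    (hy : ∀ z ∈ U, py f z = 0) : ∃ c, ∀ z ∈ U, f z = c := by
  refine hU.exists_is_const_of_fderiv_eq_zero hc (hf.differentiableOn (by simp)) fun z hz => ?_
  ext
  · simpa [px] using hx z hz
  · simpa [py] using hy z hz

/-! ### Total derivatives -/

/-- The direction `(1, y', y'', …)` of the total derivative. -/
def shift (p : Jet) : Jet := (1, fun j => p.2 (j + 1))

/-- Over `U`, the total derivative of `F` exists and equals `F'`. -/
def HasTotalDeriv (U : Set (ℝ × ℝ)) (F F' : Jet → ℝ) : Prop :=
  ∀ p : Jet, (p.1, p.2 0) ∈ U → HasDerivAt (fun t : ℝ => F (p + t • shift p)) (F' p) 0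

namespace HasTotalDeriv

variable {U : Set (ℝ × ℝ)} {F F' G G' : Jet → ℝ}

theorem totalDeriv_eq (h : HasTotalDeriv U F F') {p : Jet} (hp : (p.1, p.2 0) ∈ U) :
    totalDeriv F p = F' p := (h p hp).deriv

theorem add (hF : HasTotalDeriv U F F') (hG : HasTotalDeriv U G G') :
    HasTotalDeriv U (fun p => F p + G p) (fun p => F' p + G' p) :=
  fun p hp => (hF p hp).add (hG p hp)

theorem sub (hF : HasTotalDeriv U F F') (hG : HasTotalDeriv U G G') :
    HasTotalDeriv U (fun p => F p - G p) (fun p => F' p - G' p) :=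
  fun p hp => (hF p hp).sub (hG p hp)

theorem mul (hF : HasTotalDeriv U F F') (hG : HasTotalDeriv U G G') :
    HasTotalDeriv U (fun p => F p * G p) (fun p => F' p * G p + F p * G' p) := fun p hp => by
  have := (hF p hp).mul (hG p hp)
  simp only [zero_smul, add_zero] at this
  exact this

theorem const_mul (c : ℝ) (hF : HasTotalDeriv U F F') :
    HasTotalDeriv U (fun p => c * F p) (fun p => c * F' p) :=
  fun p hp => (hF p hp).const_mul c

theorem coord (U : Set (ℝ × ℝ)) (j : ℕ) :
    HasTotalDeriv U (fun p => p.2 j) (fun p => p.2 (j + 1)) := fun p _ => by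
  have := ((hasDerivAt_id (0 : ℝ)).mul_const (p.2 (j + 1))).const_add (p.2 j)
  simpa [shift] using this

theorem base (hU : IsOpen U) {f : ℝ × ℝ → ℝ} (hf : ContDiffOn ℝ ∞ f U) :
    HasTotalDeriv U (fun p => f (p.1, p.2 0))
      (fun p => px f (p.1, p.2 0) + p.2 1 * py f (p.1, p.2 0)) := fun p hp => by
  have h1 : DifferentiableAt ℝ f (p.1, p.2 0) :=
    (hf.contDiffAt (hU.mem_nhds hp)).differentiableAt (by simp)
  have hx : HasDerivAt (fun t : ℝ => p.1 + t) 1 0 := (hasDerivAt_id (0 : ℝ)).const_add _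
  have hy : HasDerivAt (fun t : ℝ => p.2 0 + t * p.2 1) (p.2 1) 0 := by
    simpa using ((hasDerivAt_id (0 : ℝ)).mul_const (p.2 1)).const_add (p.2 0)
  have h2 := HasFDerivAt.comp_hasDerivAt (f := fun t : ℝ => (p.1 + t, p.2 0 + t * p.2 1))
    (l := f) (l' := fderiv ℝ f (p.1, p.2 0)) 0 (by simpa using h1.hasFDerivAt) (hx.prodMk hy)
  rw [fderiv_apply_eq, one_mul] at h2
  simpa [shift, Function.comp_def] using h2

theorem eventually_mem (hU : IsOpen U) {p : Jet} (hp : (p.1, p.2 0) ∈ U) (v : Jet) :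
    ∀ᶠ t : ℝ in nhds 0, ((p + t • v).1, (p + t • v).2 0) ∈ U := by
  have hc : Continuous fun t : ℝ => ((p + t • v).1, (p + t • v).2 0) := by
    simp only [Prod.fst_add, Prod.smul_fst, Prod.snd_add, Prod.smul_snd, Pi.add_apply,
      Pi.smul_apply]
    fun_prop
  exact hc.continuousAt.eventually (hU.mem_nhds (by simpa using hp))

end HasTotalDeriv

/-- Differential functions of order at most `m` over `U`: polynomials in `y', …, y^{(m)}` whose
coefficients are smooth functions of `x` and `y`. -/
inductive JetFun (U : Set (ℝ × ℝ)) : ℕ → (Jet → ℝ) → Prop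
  | base {f : ℝ × ℝ → ℝ} (hf : ContDiffOn ℝ ∞ f U) : JetFun U 0 (fun p => f (p.1, p.2 0))
  | coord (j : ℕ) : JetFun U j (fun p => p.2 j)
  | add {m : ℕ} {F G : Jet → ℝ} : JetFun U m F → JetFun U m G → JetFun U m (fun p => F p + G p)
  | mul {m : ℕ} {F G : Jet → ℝ} : JetFun U m F → JetFun U m G → JetFun U m (fun p => F p * G p)
  | mono {m n : ℕ} {F : Jet → ℝ} : m ≤ n → JetFun U m F → JetFun U n F

namespace JetFun

variable {U : Set (ℝ × ℝ)} {m : ℕ} {F G : Jet → ℝ}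

theorem base' (m : ℕ) {f : ℝ × ℝ → ℝ} (hf : ContDiffOn ℝ ∞ f U) :
    JetFun U m (fun p => f (p.1, p.2 0)) := mono (Nat.zero_le m) (base hf)

theorem coord' {j m : ℕ} (h : j ≤ m) : JetFun U m (fun p => p.2 j) := mono h (coord j)

theorem const (m : ℕ) (c : ℝ) : JetFun U m (fun _ => c) :=
  base' (f := fun _ => c) m contDiffOn_const

theorem const_mul (c : ℝ) (hF : JetFun U m F) : JetFun U m (fun p => c * F p) :=
  (const m c).mul hF

theorem sub (hF : JetFun U m F) (hG : JetFun U m G) : JetFun U m (fun p => F p - G p) := by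
  simpa [sub_eq_add_neg] using hF.add (hG.const_mul (-1))

/-- `lineDeriv` obeys the sum and product rules only where the derivative exists, so existence is
carried along with the value. The class is closed under total differentiation at the cost of one
order. -/
theorem exists_hasTotalDeriv (hU : IsOpen U) (h : JetFun U m F) :
    ∃ F', HasTotalDeriv U F F' ∧ JetFun U (m + 1) F' := by
  induction h with
  | base hf =>
    exact ⟨_, HasTotalDeriv.base hU hf, (base' 1 (contDiffOn_px hU hf)).add
      ((coord 1).mul (base' 1 (contDiffOn_py hU hf)))⟩
  | coord j => exact ⟨_, HasTotalDeriv.coord U j, coord (j + 1)⟩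
  | add _ _ ih1 ih2 =>
    obtain ⟨F', h1, h2⟩ := ih1
    obtain ⟨G', h3, h4⟩ := ih2
    exact ⟨_, h1.add h3, h2.add h4⟩
  | mul hF hG ih1 ih2 =>
    obtain ⟨F', h1, h2⟩ := ih1
    obtain ⟨G', h3, h4⟩ := ih2
    exact ⟨_, h1.mul h3, (h2.mul (hG.mono (Nat.le_succ _))).add ((hF.mono (Nat.le_succ _)).mul h4)⟩
  | mono h _ ih =>
    obtain ⟨F', h1, h2⟩ := ih
    exact ⟨F', h1, h2.mono (Nat.succ_le_succ h)⟩

theorem congr_jet (h : JetFun U m F) {p q : Jet} (hx : p.1 = q.1)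
    (hy : ∀ j ≤ m, p.2 j = q.2 j) : F p = F q := by
  induction h with
  | base hf => simp only [hx, hy 0 le_rfl]
  | coord j => exact hy j le_rfl
  | add _ _ ih1 ih2 => simp only [ih1 hy, ih2 hy]
  | mul _ _ ih1 ih2 => simp only [ih1 hy, ih2 hy]
  | mono h _ ih => exact ih fun j hj => hy j (hj.trans h)

end JetFun

/-! ### The structure of prolongation coefficients -/

/-- The total derivative of a function of `x` and `y`. -/
def baseDeriv (f : ℝ × ℝ → ℝ) (p : Jet) : ℝ :=
  px f (p.1, p.2 0) + p.2 1 * py f (p.1, p.2 0)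

section

variable {U : Set (ℝ × ℝ)}

/-- The total derivative only uses the values on a short line through `p`, and such a line stays
over the open set `U`. -/
theorem totalDeriv_congr (hU : IsOpen U) {F G : Jet → ℝ}
    (h : ∀ p : Jet, (p.1, p.2 0) ∈ U → F p = G p) {p : Jet} (hp : (p.1, p.2 0) ∈ U) :
    totalDeriv F p = totalDeriv G p := by
  refine Filter.EventuallyEq.deriv_eq ?_
  filter_upwards [HasTotalDeriv.eventually_mem hU hp (shift p)] with t ht using h _ ht

theorem prolongCoeff_congr (hU : IsOpen U) {V W : ℝ × ℝ → ℝ × ℝ} (h : ∀ z ∈ U, V z = W z)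
    (j : ℕ) : ∀ p : Jet, (p.1, p.2 0) ∈ U → prolongCoeff V j p = prolongCoeff W j p := by
  induction j with
  | zero => intro p hp; simp only [prolongCoeff, h _ hp]
  | succ j ih =>
    intro p hp
    simp only [prolongCoeff]
    rw [totalDeriv_congr hU ih hp, totalDeriv_congr hU (F := fun q => (V (q.1, q.2 0)).1)
      (G := fun q => (W (q.1, q.2 0)).1) (fun q hq => by rw [h _ hq]) hp]

theorem hasTotalDeriv_base (hU : IsOpen U) {f : ℝ × ℝ → ℝ} (hf : ContDiffOn ℝ ∞ f U) :
    HasTotalDeriv U (fun p => f (p.1, p.2 0)) (baseDeriv f) := HasTotalDeriv.base hU hf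

theorem hasTotalDeriv_baseDeriv (hU : IsOpen U) {f : ℝ × ℝ → ℝ} (hf : ContDiffOn ℝ ∞ f U) :
    HasTotalDeriv U (baseDeriv f)
      (fun p => baseDeriv (px f) p
        + (p.2 2 * py f (p.1, p.2 0) + p.2 1 * baseDeriv (py f) p)) :=
  (hasTotalDeriv_base hU (contDiffOn_px hU hf)).add
    ((HasTotalDeriv.coord U 1).mul (hasTotalDeriv_base hU (contDiffOn_py hU hf)))

theorem jetFun_baseDeriv (hU : IsOpen U) {f : ℝ × ℝ → ℝ} (hf : ContDiffOn ℝ ∞ f U) :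
    JetFun U 1 (baseDeriv f) :=
  (JetFun.base' 1 (contDiffOn_px hU hf)).add
    ((JetFun.coord 1).mul (JetFun.base' 1 (contDiffOn_py hU hf)))

end

section

variable {U : Set (ℝ × ℝ)} {X Y : ℝ × ℝ → ℝ}

local notation "V" => (fun z => (X z, Y z) : ℝ × ℝ → ℝ × ℝ)

theorem prolongCoeff_succ_of_hasTotalDeriv (hU : IsOpen U) (hX : ContDiffOn ℝ ∞ X U)
    {j : ℕ} {F F' : Jet → ℝ} (h : ∀ p : Jet, (p.1, p.2 0) ∈ U → prolongCoeff V j p = F p)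
    (hF : HasTotalDeriv U F F') {p : Jet} (hp : (p.1, p.2 0) ∈ U) :
    prolongCoeff V (j + 1) p = F' p - p.2 (j + 1) * baseDeriv X p := by
  simp only [prolongCoeff]
  rw [totalDeriv_congr hU h hp, hF.totalDeriv_eq hp, (hasTotalDeriv_base hU hX).totalDeriv_eq hp]

theorem exists_jetFun_prolongCoeff (hU : IsOpen U) (hX : ContDiffOn ℝ ∞ X U)
    (hY : ContDiffOn ℝ ∞ Y U) (j : ℕ) :
    ∃ F, JetFun U j F ∧ ∀ p : Jet, (p.1, p.2 0) ∈ U → prolongCoeff V j p = F p := by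
  induction j with
  | zero => exact ⟨_, JetFun.base hY, fun p _ => rfl⟩
  | succ j ih =>
    obtain ⟨F, h1, h2⟩ := ih
    obtain ⟨F', h3, h4⟩ := h1.exists_hasTotalDeriv hU
    exact ⟨_, h4.sub ((JetFun.coord (j + 1)).mul
      ((jetFun_baseDeriv hU hX).mono (Nat.le_add_left 1 j))),
      fun p hp => prolongCoeff_succ_of_hasTotalDeriv hU hX h2 h3 hp⟩

/-- Prolongation coefficients of order `j` only see the jet coordinates up to order `j`. -/
theorem prolongCoeff_congr_jet (hU : IsOpen U) (hX : ContDiffOn ℝ ∞ X U)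
    (hY : ContDiffOn ℝ ∞ Y U) (j : ℕ) {p q : Jet} (hp : (p.1, p.2 0) ∈ U) (hx : p.1 = q.1)
    (hy : ∀ i ≤ j, p.2 i = q.2 i) : prolongCoeff V j p = prolongCoeff V j q := by
  obtain ⟨F, h1, h2⟩ := exists_jetFun_prolongCoeff hU hX hY j
  rw [h2 p hp, h2 q (by rw [← hx, ← hy 0 (Nat.zero_le j)]; exact hp), h1.congr_jet hx hy]

/-- The coefficient of `y^{(j)}` in `η^{(j)}`. -/
def topCoeff (X Y : ℝ × ℝ → ℝ) (j : ℕ) (p : Jet) : ℝ :=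
  py Y (p.1, p.2 0) - p.2 1 * py X (p.1, p.2 0) - j * baseDeriv X p

/-- The total derivative of `topCoeff X Y j`. -/
def topCoeffDeriv (X Y : ℝ × ℝ → ℝ) (j : ℕ) (p : Jet) : ℝ :=
  baseDeriv (py Y) p - (p.2 2 * py X (p.1, p.2 0) + p.2 1 * baseDeriv (py X) p)
    - j * (baseDeriv (px X) p + (p.2 2 * py X (p.1, p.2 0) + p.2 1 * baseDeriv (py X) p))

/-- The coefficient of `y^{(j-1)}` in `η^{(j)}`. -/
def subCoeff (X Y : ℝ × ℝ → ℝ) (j : ℕ) (p : Jet) : ℝ :=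
  j * (baseDeriv (py Y) p - p.2 1 * baseDeriv (py X) p - p.2 2 * py X (p.1, p.2 0))
    - j * (j - 1) / 2
      * (baseDeriv (px X) p + (p.2 2 * py X (p.1, p.2 0) + p.2 1 * baseDeriv (py X) p))

theorem hasTotalDeriv_topCoeff (hU : IsOpen U) (hX : ContDiffOn ℝ ∞ X U)
    (hY : ContDiffOn ℝ ∞ Y U) (j : ℕ) :
    HasTotalDeriv U (topCoeff X Y j) (topCoeffDeriv X Y j) :=
  ((hasTotalDeriv_base hU (contDiffOn_py hU hY)).sub ((HasTotalDeriv.coord U 1).mul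
    (hasTotalDeriv_base hU (contDiffOn_py hU hX)))).sub
    ((hasTotalDeriv_baseDeriv hU hX).const_mul j)

theorem jetFun_subCoeff (hU : IsOpen U) (hX : ContDiffOn ℝ ∞ X U)
    (hY : ContDiffOn ℝ ∞ Y U) (j : ℕ) : JetFun U 2 (subCoeff X Y j) := by
  have one : ∀ {f : ℝ × ℝ → ℝ}, ContDiffOn ℝ ∞ f U → JetFun U 2 (baseDeriv f) :=
    fun hf => (jetFun_baseDeriv hU hf).mono (by norm_num)
  have hXy := contDiffOn_py hU hX
  have c1 : JetFun U 2 (fun p => p.2 1) := JetFun.coord' (by norm_num)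
  exact (JetFun.const_mul _ (((one (contDiffOn_py hU hY)).sub (c1.mul (one hXy))).sub
    ((JetFun.coord 2).mul (JetFun.base' 2 hXy)))).sub
    (JetFun.const_mul _ ((one (contDiffOn_px hU hX)).add
      (((JetFun.coord 2).mul (JetFun.base' 2 hXy)).add (c1.mul (one hXy)))))

/-- Leibniz rule: differentiating A_j y^{(j)} + B_j y^{(j-1)} gives y^{(j)} the coefficient D A_j +
B_j. Summing these recursions produces the binomial factor j(j-1)/2 in `subCoeff`. -/
theorem subCoeff_succ (j : ℕ) (p : Jet) :
    subCoeff X Y (j + 1) p = subCoeff X Y j p + topCoeffDeriv X Y j p := by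
  simp only [subCoeff, topCoeffDeriv]
  push_cast
  ring

theorem topCoeff_succ (j : ℕ) (p : Jet) :
    topCoeff X Y (j + 1) p = topCoeff X Y j p - baseDeriv X p := by
  simp only [topCoeff]
  push_cast
  ring

theorem prolongCoeff_one (hU : IsOpen U) (hX : ContDiffOn ℝ ∞ X U) (hY : ContDiffOn ℝ ∞ Y U)
    {p : Jet} (hp : (p.1, p.2 0) ∈ U) :
    prolongCoeff V 1 p = baseDeriv Y p - p.2 1 * baseDeriv X p :=
  prolongCoeff_succ_of_hasTotalDeriv hU hX (j := 0) (fun _ _ => rfl)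
    (hasTotalDeriv_base hU hY) hp

theorem prolongCoeff_two (hU : IsOpen U) (hX : ContDiffOn ℝ ∞ X U) (hY : ContDiffOn ℝ ∞ Y U)
    {p : Jet} (hp : (p.1, p.2 0) ∈ U) :
    prolongCoeff V 2 p = topCoeff X Y 2 p * p.2 2
      + ((baseDeriv (px Y) p + p.2 1 * baseDeriv (py Y) p)
        - p.2 1 * (baseDeriv (px X) p + p.2 1 * baseDeriv (py X) p)) := by
  rw [prolongCoeff_succ_of_hasTotalDeriv hU hX (j := 1)
    (fun _ hq => prolongCoeff_one hU hX hY hq)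
    ((hasTotalDeriv_baseDeriv hU hY).sub
      ((HasTotalDeriv.coord U 1).mul (hasTotalDeriv_baseDeriv hU hX))) hp]
  simp only [topCoeff]
  push_cast
  ring

/-- Order 3 is separate because here y'' is both the subleading variable and part of its own
coefficient: the term -3 (y'')^2 X_y is quadratic. Its derivative is linear in y''' with coefficient
-6 y'' X_y, so the uniform formula starts at order 4. -/
theorem exists_prolongCoeff_three (hU : IsOpen U) (hX : ContDiffOn ℝ ∞ X U)
    (hY : ContDiffOn ℝ ∞ Y U) :
    ∃ R, JetFun U 1 R ∧ ∀ p : Jet, (p.1, p.2 0) ∈ U →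
      prolongCoeff V 3 p = topCoeff X Y 3 p * p.2 3
        + p.2 2 * (3 * ((baseDeriv (py Y) p - p.2 1 * baseDeriv (py X) p)
            - (baseDeriv (px X) p + p.2 1 * baseDeriv (py X) p))
          - 3 * (p.2 2 * py X (p.1, p.2 0))) + R p := by
  have hXx := contDiffOn_px hU hX
  have hXy := contDiffOn_py hU hX
  have hYx := contDiffOn_px hU hY
  have hYy := contDiffOn_py hU hY
  have c1 := JetFun.coord (U := U) 1
  have D2 : ∀ {f : ℝ × ℝ → ℝ}, ContDiffOn ℝ ∞ f U →
      JetFun U 1 (fun p => baseDeriv (px f) p + p.2 1 * baseDeriv (py f) p) := fun hf =>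
    (jetFun_baseDeriv hU (contDiffOn_px hU hf)).add
      (c1.mul (jetFun_baseDeriv hU (contDiffOn_py hU hf)))
  refine ⟨_, ((D2 hYx).add (c1.mul (D2 hYy))).sub (c1.mul ((D2 hXx).add (c1.mul (D2 hXy)))),
    fun p hp => ?_⟩
  rw [prolongCoeff_succ_of_hasTotalDeriv hU hX (j := 2)
    (fun _ hq => prolongCoeff_two hU hX hY hq)
    (((hasTotalDeriv_topCoeff hU hX hY 2).mul (HasTotalDeriv.coord U 2)).add
      (((hasTotalDeriv_baseDeriv hU hYx).add
        ((HasTotalDeriv.coord U 1).mul (hasTotalDeriv_baseDeriv hU hYy))).sub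
        ((HasTotalDeriv.coord U 1).mul ((hasTotalDeriv_baseDeriv hU hXx).add
          ((HasTotalDeriv.coord U 1).mul (hasTotalDeriv_baseDeriv hU hXy)))))) hp]
  have e1 := py_px hU hX hp
  have e2 := py_px hU hY hp
  simp only [topCoeff, topCoeffDeriv]
  simp only [baseDeriv, e1, e2]
  push_cast
  ring

/-- For `j ≥ 4`, the two leading terms of `η^{(j)}`. -/
theorem exists_prolongCoeff_eq (hU : IsOpen U) (hX : ContDiffOn ℝ ∞ X U)
    (hY : ContDiffOn ℝ ∞ Y U) (i : ℕ) :
    ∃ R, JetFun U (i + 2) R ∧ ∀ p : Jet, (p.1, p.2 0) ∈ U →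
      prolongCoeff V (i + 4) p = topCoeff X Y (i + 4) p * p.2 (i + 4)
        + subCoeff X Y (i + 4) p * p.2 (i + 3) + R p := by
  induction i with
  | zero =>
    obtain ⟨R, hR, h⟩ := exists_prolongCoeff_three hU hX hY
    have hXx := contDiffOn_px hU hX
    have hXy := contDiffOn_py hU hX
    have hYy := contDiffOn_py hU hY
    have c1 := JetFun.coord (U := U) 1
    have hP : JetFun U 1 (fun p => 3 * ((baseDeriv (py Y) p - p.2 1 * baseDeriv (py X) p)
            - (baseDeriv (px X) p + p.2 1 * baseDeriv (py X) p))) :=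
      JetFun.const_mul _ (((jetFun_baseDeriv hU hYy).sub (c1.mul (jetFun_baseDeriv hU hXy))).sub
        ((jetFun_baseDeriv hU hXx).add (c1.mul (jetFun_baseDeriv hU hXy))))
    obtain ⟨P', hP1, hP2⟩ := hP.exists_hasTotalDeriv hU
    obtain ⟨R', hR1, hR2⟩ := hR.exists_hasTotalDeriv hU
    have c2 := JetFun.coord (U := U) 2
    refine ⟨_, (c2.mul (hP2.sub (JetFun.const_mul 3 (c2.mul
      ((jetFun_baseDeriv hU hXy).mono (by norm_num)))))).add hR2, fun p hp => ?_⟩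
    rw [prolongCoeff_succ_of_hasTotalDeriv hU hX (j := 3) h
      ((((hasTotalDeriv_topCoeff hU hX hY 3).mul (HasTotalDeriv.coord U 3)).add
        ((HasTotalDeriv.coord U 2).mul (hP1.sub (((HasTotalDeriv.coord U 2).mul
          (hasTotalDeriv_base hU hXy)).const_mul 3)))).add hR1) hp]
    simp only [topCoeff, topCoeffDeriv, subCoeff]
    push_cast
    ring
  | succ i ih =>
    obtain ⟨R, hR, h⟩ := ih
    obtain ⟨R', hR1, hR2⟩ := hR.exists_hasTotalDeriv hU
    obtain ⟨B', hB1, hB2⟩ := (jetFun_subCoeff hU hX hY (i + 4)).exists_hasTotalDeriv hU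
    -- The coefficient B_j has order 2, so D B_j has order 3 ≤ j - 1 for j = i + 4, and the product
    -- with y^{(j-1)} goes into the remainder.
    refine ⟨_, ((hB2.mono (by omega)).mul (JetFun.coord (i + 3))).add hR2, fun p hp => ?_⟩
    rw [show i + 1 + 4 = (i + 4) + 1 by ring, prolongCoeff_succ_of_hasTotalDeriv hU hX h
      ((((hasTotalDeriv_topCoeff hU hX hY (i + 4)).mul (HasTotalDeriv.coord U (i + 4))).add
        (hB1.mul (HasTotalDeriv.coord U (i + 3)))).add hR1) hp, topCoeff_succ (i + 4),
      subCoeff_succ (i + 4), show i + 4 + 1 = i + 5 by ring, show i + 3 + 1 = i + 4 by ring]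
    ring

/-- For `j ≥ 3`, the leading term of `η^{(j)}`. -/
theorem exists_prolongCoeff_eq_top (hU : IsOpen U) (hX : ContDiffOn ℝ ∞ X U)
    (hY : ContDiffOn ℝ ∞ Y U) (i : ℕ) :
    ∃ R, JetFun U (i + 2) R ∧ ∀ p : Jet, (p.1, p.2 0) ∈ U →
      prolongCoeff V (i + 3) p = topCoeff X Y (i + 3) p * p.2 (i + 3) + R p := by
  cases i with
  | zero =>
    obtain ⟨R, hR, h⟩ := exists_prolongCoeff_three hU hX hY
    have hXx := contDiffOn_px hU hX
    have hXy := contDiffOn_py hU hX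
    have hYy := contDiffOn_py hU hY
    have c1 := JetFun.coord (U := U) 1
    have c2 := JetFun.coord (U := U) 2
    have hP : JetFun U 1 (fun p => 3 * ((baseDeriv (py Y) p - p.2 1 * baseDeriv (py X) p)
            - (baseDeriv (px X) p + p.2 1 * baseDeriv (py X) p))) :=
      JetFun.const_mul _ (((jetFun_baseDeriv hU hYy).sub (c1.mul (jetFun_baseDeriv hU hXy))).sub
        ((jetFun_baseDeriv hU hXx).add (c1.mul (jetFun_baseDeriv hU hXy))))
    refine ⟨_, (c2.mul ((hP.mono (by norm_num)).sub
      (JetFun.const_mul 3 (c2.mul (JetFun.base' 2 hXy))))).add (hR.mono (by norm_num)),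
      fun p hp => ?_⟩
    rw [h p hp]
    ring
  | succ i =>
    obtain ⟨R, hR, h⟩ := exists_prolongCoeff_eq hU hX hY i
    refine ⟨_, (((jetFun_subCoeff hU hX hY (i + 4)).mono (by omega)).mul
      (JetFun.coord (i + 3))).add (hR.mono (by omega)), fun p hp => ?_⟩
    rw [show i + 1 + 3 = i + 4 by ring, h p hp]
    ring

/-! ### Prolongation at straight-line jets -/

theorem px_iterate_contDiffOn (hU : IsOpen U) (hX : ContDiffOn ℝ ∞ X U) (j : ℕ) :
    ContDiffOn ℝ ∞ (px^[j] X) U := by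
  induction j with
  | zero => exact hX
  | succ j ih => rw [Function.iterate_succ_apply']; exact contDiffOn_px hU ih

theorem py_iterate_contDiffOn (hU : IsOpen U) (hX : ContDiffOn ℝ ∞ X U) (j : ℕ) :
    ContDiffOn ℝ ∞ (py^[j] X) U := by
  induction j with
  | zero => exact hX
  | succ j ih => rw [Function.iterate_succ_apply']; exact contDiffOn_py hU ih

theorem px_zero (z : ℝ × ℝ) : px (fun _ => 0) z = 0 := by simp [px]

theorem py_zero (z : ℝ × ℝ) : py (fun _ => 0) z = 0 := by simp [py]

theorem py_px_iterate (hU : IsOpen U) (hX : ContDiffOn ℝ ∞ X U) (h : ∀ z ∈ U, py X z = 0)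
    (j : ℕ) : ∀ z ∈ U, py (px^[j] X) z = 0 := by
  induction j with
  | zero => exact h
  | succ j ih =>
    intro z hz
    rw [Function.iterate_succ_apply', py_px hU (px_iterate_contDiffOn hU hX j) hz,
      (px_py_congr hU ih hz).1, px_zero]

theorem px_py_iterate (hU : IsOpen U) (hX : ContDiffOn ℝ ∞ X U) (h : ∀ z ∈ U, px X z = 0)
    (j : ℕ) : ∀ z ∈ U, px (py^[j] X) z = 0 := by
  induction j with
  | zero => exact h
  | succ j ih =>
    intro z hz
    rw [Function.iterate_succ_apply', ← py_px hU (py_iterate_contDiffOn hU hX j) hz,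
      (px_py_congr hU ih hz).2, py_zero]

/-- The prolongation coefficients of `ξ(x) ∂_x + η(y) ∂_y` at jets of straight lines. -/
theorem prolongCoeff_line (hU : IsOpen U) (hX : ContDiffOn ℝ ∞ X U) (hY : ContDiffOn ℝ ∞ Y U)
    (hXy : ∀ z ∈ U, py X z = 0) (hYx : ∀ z ∈ U, px Y z = 0) (j : ℕ) :
    ∀ p : Jet, (p.1, p.2 0) ∈ U → (∀ i, 2 ≤ i → p.2 i = 0) →
      prolongCoeff V (j + 1) p = p.2 1 ^ (j + 1) * (py^[j + 1] Y) (p.1, p.2 0)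
        - p.2 1 * (px^[j + 1] X) (p.1, p.2 0) := by
  induction j with
  | zero =>
    intro p hp _
    rw [prolongCoeff_one hU hX hY hp]
    simp only [baseDeriv, hXy _ hp, hYx _ hp, zero_add, Function.iterate_one]
    ring
  | succ j ih =>
    intro p hp h2
    have hX' := px_iterate_contDiffOn hU hX (j + 1)
    have hY' := py_iterate_contDiffOn hU hY (j + 1)
    have key := (((hasTotalDeriv_base hU hY').const_mul (p.2 1 ^ (j + 1))).sub
      ((hasTotalDeriv_base hU hX').const_mul (p.2 1))) p hp
    have hev : (fun t : ℝ => prolongCoeff V (j + 1) (p + t • shift p)) =ᶠ[nhds 0]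
        fun t : ℝ => p.2 1 ^ (j + 1)
            * (py^[j + 1] Y) ((p + t • shift p).1, (p + t • shift p).2 0)
          - p.2 1 * (px^[j + 1] X) ((p + t • shift p).1, (p + t • shift p).2 0) := by
      filter_upwards [HasTotalDeriv.eventually_mem hU hp (shift p)] with t ht
      -- Since y'' and all higher coordinates vanish, moving along `shift p` keeps the jet straight
      -- and its slope constant; only x and y vary.
      have e1 : (p + t • shift p).2 1 = p.2 1 := by simp [shift, h2 2 le_rfl]
      rw [ih _ ht (fun i hi => by simp [shift, h2 i hi, h2 (i + 1) (by omega)]), e1]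
    have h3 : totalDeriv (prolongCoeff V (j + 1)) p = _ := hev.deriv_eq.trans key.deriv
    change totalDeriv (prolongCoeff V (j + 1)) p - p.2 (j + 1 + 1) * _ = _
    rw [h3, h2 (j + 1 + 1) (by omega)]
    simp only [baseDeriv, px_py_iterate hU hY hYx (j + 1) _ hp,
      py_px_iterate hU hX hXy (j + 1) _ hp]
    rw [Function.iterate_succ_apply' py (j + 1), Function.iterate_succ_apply' px (j + 1)]
    ring

end

/-! ### Directional derivatives of the equations -/

/-- In terms of r = y''/y' the exceptional last term is a (n+2) r^{n+2} y'', the case q = n + 1 of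
the general term, so a single sum suffices. -/
theorem baseLHS_eq (n : ℕ) (a : ℕ → ℝ) {p : Jet} (hp : p.2 1 ≠ 0) :
    baseLHS (n + 4) a p = p.2 (n + 4)
      - ∑ q ∈ Finset.range (n + 2), a (q + 1) * (p.2 2 / p.2 1) ^ (q + 1) * p.2 (n + 3 - q) := by
  rw [baseLHS, Finset.sum_range_succ, show n + 4 - 3 = n + 1 by omega,
    show n + 4 - 2 = n + 2 by omega, show n + 4 - 1 = n + 3 by omega,
    ← Finset.Ico_add_one_right_eq_Icc, Finset.sum_Ico_eq_sum_range,
    show n + 1 + 1 - 1 = n + 1 by omega, show n + 3 - (n + 1) = 2 by omega, ← sub_sub]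
  congr 1
  · congr 1
    refine Finset.sum_congr rfl fun q hq => ?_
    have hq' := Finset.mem_range.1 hq
    obtain ⟨m, rfl⟩ : ∃ m, n = q + m := ⟨n - q, by omega⟩
    rw [show q + m + 2 - (1 + q) = m + 1 by omega, show q + m + 4 - (1 + q) = m + 3 by omega,
      show q + m + 3 - q = m + 3 by omega, add_comm 1 q, div_pow]
    field_simp
    ring
  · rw [div_pow]
    field_simp
    ring

theorem modifiedLHS_eq (n : ℕ) (a : ℕ → ℝ) {p : Jet} (hp : p.2 1 ≠ 0) :
    modifiedLHS (n + 4) a p = baseLHS (n + 4) a p + (p.2 0 * p.2 1 ^ (n + 4)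
      + (2 * p.2 1 * p.2 3 - 3 * p.2 2 ^ 2) * p.2 1 ^ n) := by
  rw [modifiedLHS, pow_add]
  field_simp

/-- The derivative of `baseLHS (n + 4) a` at the jet `p` in the direction `∑ v_j ∂/∂y^{(j)}`. -/
def baseDir (n : ℕ) (a : ℕ → ℝ) (p : Jet) (v : ℕ → ℝ) : ℝ :=
  v (n + 4) - ∑ q ∈ Finset.range (n + 2), a (q + 1) *
    ((q + 1) * (p.2 2 / p.2 1) ^ q * (v 2 / p.2 1 - p.2 2 * v 1 / p.2 1 ^ 2) * p.2 (n + 3 - q)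
      + (p.2 2 / p.2 1) ^ (q + 1) * v (n + 3 - q))

theorem hasDerivAt_coord (p v : Jet) (j : ℕ) :
    HasDerivAt (fun t : ℝ => (p + t • v).2 j) (v.2 j) 0 := by
  simpa using ((hasDerivAt_id (0 : ℝ)).mul_const (v.2 j)).const_add (p.2 j)

theorem eventually_ne_zero {p : Jet} (hp : p.2 1 ≠ 0) (v : Jet) :
    ∀ᶠ t : ℝ in nhds 0, (p + t • v).2 1 ≠ 0 :=
  (hasDerivAt_coord p v 1).continuousAt.eventually_ne (by simpa using hp)

theorem hasDerivAt_baseLHS (n : ℕ) (a : ℕ → ℝ) {p : Jet} (hp : p.2 1 ≠ 0) (v : Jet) :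
    HasDerivAt (fun t : ℝ => baseLHS (n + 4) a (p + t • v)) (baseDir n a p v.2) 0 := by
  have hr : HasDerivAt (fun t : ℝ => (p + t • v).2 2 / (p + t • v).2 1)
      (v.2 2 / p.2 1 - p.2 2 * v.2 1 / p.2 1 ^ 2) 0 := by
    refine ((hasDerivAt_coord p v 2).div (hasDerivAt_coord p v 1)
      (by simpa using hp)).congr_deriv ?_
    simp only [zero_smul, add_zero]
    field_simp
  have hs := HasDerivAt.fun_sum (u := Finset.range (n + 2)) (fun q _ =>
    ((hr.fun_pow (q + 1)).const_mul (a (q + 1))).mul (hasDerivAt_coord p v (n + 3 - q)))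
  refine HasDerivAt.congr_of_eventuallyEq (((hasDerivAt_coord p v (n + 4)).sub hs).congr_deriv ?_)
    ?_
  · rw [baseDir]
    congr 1
    refine Finset.sum_congr rfl fun q _ => ?_
    simp only [zero_smul, add_zero, Nat.add_sub_cancel]
    push_cast
    ring
  · filter_upwards [eventually_ne_zero hp v] with t ht
    rw [baseLHS_eq n a ht]
    rfl

/-- The derivative of `modifiedLHS (n + 4) a` at the jet `p` in the direction
`∑ v_j ∂/∂y^{(j)}`. -/
def modifiedDir (n : ℕ) (a : ℕ → ℝ) (p : Jet) (v : ℕ → ℝ) : ℝ :=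
  baseDir n a p v + (v 0 * p.2 1 ^ (n + 4) + p.2 0 * ((n + 4) * p.2 1 ^ (n + 3) * v 1)
    + ((2 * v 1 * p.2 3 + 2 * p.2 1 * v 3 - 6 * p.2 2 * v 2) * p.2 1 ^ n
      -- For n = 0 the truncated exponent n - 1 is harmless because of the factor n.
      + (2 * p.2 1 * p.2 3 - 3 * p.2 2 ^ 2) * (n * p.2 1 ^ (n - 1) * v 1)))

theorem hasDerivAt_modifiedLHS (n : ℕ) (a : ℕ → ℝ) {p : Jet} (hp : p.2 1 ≠ 0) (v : Jet) :
    HasDerivAt (fun t : ℝ => modifiedLHS (n + 4) a (p + t • v)) (modifiedDir n a p v.2) 0 := by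
  have h0 := hasDerivAt_coord p v 0
  have h1 := hasDerivAt_coord p v 1
  have h2 := hasDerivAt_coord p v 2
  have h3 := hasDerivAt_coord p v 3
  refine HasDerivAt.congr_of_eventuallyEq (((hasDerivAt_baseLHS n a hp v).add
    ((h0.mul (h1.fun_pow (n + 4))).add ((((h1.const_mul 2).mul h3).sub
      ((h2.fun_pow 2).const_mul 3)).mul (h1.fun_pow n)))).congr_deriv ?_) ?_
  · simp only [modifiedDir, zero_smul, add_zero, Pi.sub_apply, Pi.mul_apply]
    rw [show n + 4 - 1 = n + 3 by omega]
    push_cast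
    ring
  · filter_upwards [eventually_ne_zero hp v] with t ht
    rw [modifiedLHS_eq n a ht]
    rfl

theorem prolong_baseLHS (n : ℕ) (a : ℕ → ℝ) {p : Jet} (hp : p.2 1 ≠ 0) (V : ℝ × ℝ → ℝ × ℝ) :
    prolong V (baseLHS (n + 4) a) p = baseDir n a p (fun j => prolongCoeff V j p) :=
  (hasDerivAt_baseLHS n a hp _).deriv

theorem prolong_modifiedLHS (n : ℕ) (a : ℕ → ℝ) {p : Jet} (hp : p.2 1 ≠ 0)
    (V : ℝ × ℝ → ℝ × ℝ) :
    prolong V (modifiedLHS (n + 4) a) p = modifiedDir n a p (fun j => prolongCoeff V j p) :=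
  (hasDerivAt_modifiedLHS n a hp _).deriv

/-! ### The fields `(α + β x + γ x²) ∂_x` -/

/-- The vector field `(α + β x + γ x²) ∂_x`. -/
def quadField (α β γ : ℝ) (z : ℝ × ℝ) : ℝ × ℝ := (α + β * z.1 + γ * z.1 ^ 2, 0)

theorem baseDeriv_quad (α β γ : ℝ) (p : Jet) :
    baseDeriv (fun z => α + β * z.1 + γ * z.1 ^ 2) p = β + 2 * γ * p.1 := by
  have h : ∀ z : ℝ × ℝ, HasFDerivAt (fun z : ℝ × ℝ => α + β * z.1 + γ * z.1 ^ 2)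
      ((β + 2 * γ * z.1) • ContinuousLinearMap.fst ℝ ℝ ℝ) z := by
    intro z
    have h1 : HasDerivAt (fun x : ℝ => α + β * x + γ * x ^ 2) (β + 2 * γ * z.1) z.1 := by
      refine ((((hasDerivAt_id z.1).const_mul β).const_add α).add
        (((hasDerivAt_id z.1).fun_pow 2).const_mul γ)).congr_deriv ?_
      simp
      ring
    exact h1.comp_hasFDerivAt z hasFDerivAt_fst
  simp [baseDeriv, px, py, (h _).fderiv]

theorem contDiff_quad (α β γ : ℝ) :
    ContDiff ℝ ∞ (fun z : ℝ × ℝ => α + β * z.1 + γ * z.1 ^ 2) := by fun_prop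

theorem prolongCoeff_quadField (α β γ : ℝ) (j : ℕ) (p : Jet) :
    prolongCoeff (quadField α β γ) j p
      = -(j * ((β + 2 * γ * p.1) * p.2 j) + γ * (j * (j - 1)) * p.2 (j - 1)) := by
  have hX := (contDiff_quad α β γ).contDiffOn (s := Set.univ)
  -- The derivative β + 2γx is treated as a quadratic with zero leading coefficient, so that
  -- `baseDeriv_quad` applies to it as well.
  have hX' := (contDiff_quad β (2 * γ) 0).contDiffOn (s := Set.univ)
  induction j generalizing p with
  | zero => simp [prolongCoeff, quadField]
  | succ j ih =>
    have h1 := hasTotalDeriv_base isOpen_univ hX'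
    have h2 := ((h1.mul (HasTotalDeriv.coord Set.univ j)).const_mul (j : ℝ)).add
      ((HasTotalDeriv.coord Set.univ (j - 1)).const_mul (γ * (j * (j - 1))))
    have h3 : ∀ q : Jet, (q.1, q.2 0) ∈ Set.univ → prolongCoeff (quadField α β γ) j q
        = -1 * (j * ((β + 2 * γ * q.1 + 0 * q.1 ^ 2) * q.2 j)
          + γ * (j * (j - 1)) * q.2 (j - 1)) := fun q _ => by
      rw [ih q]
      ring
    refine (prolongCoeff_succ_of_hasTotalDeriv (Y := fun _ => 0) isOpen_univ hX h3
      (h2.const_mul (-1)) (Set.mem_univ _)).trans ?_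
    rw [baseDeriv_quad, baseDeriv_quad]
    cases j with
    | zero => simp [mul_comm]
    | succ j =>
      simp only [Nat.add_sub_cancel]
      push_cast
      ring

/-- The defect of the coefficients `b` in the recursion expressing invariance under `x² ∂_x`. -/
def defect (n : ℕ) (b : ℕ → ℝ) (q : ℕ) : ℝ :=
  2 * (q + 1) * b (q + 1)
    + ((n : ℝ) + 4 - q) * (n + 3 - q) * (if q = 0 then -1 else b q)
    + (if q = n + 1 then 2 * b (n + 2) else 0)

/-- Under the ξ' part of the prolongation r has weight -1 and y^{(j)} has weight -j, so every
monomial of the left side has weight -(n+4). The constant ξ'' = 2γ lowers one derivative and yields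
the defects. -/
theorem baseDir_quadField (n : ℕ) (b : ℕ → ℝ) (α β γ : ℝ) {p : Jet} (hp : p.2 1 ≠ 0) :
    baseDir n b p (fun j => prolongCoeff (quadField α β γ) j p)
      = -(n + 4) * (β + 2 * γ * p.1) * baseLHS (n + 4) b p
        + γ * ∑ q ∈ Finset.range (n + 2), defect n b q * (p.2 2 / p.2 1) ^ q * p.2 (n + 3 - q) := by
  rw [baseLHS_eq n b hp, baseDir]
  simp only [prolongCoeff_quadField]
  set m := β + 2 * γ * p.1
  set r := p.2 2 / p.2 1 with hr
  have hr2 : p.2 2 = r * p.2 1 := by rw [hr]; field_simp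
  -- The contribution of lowering y^{(n+4-q)} in the q-th monomial; the value -1 at q = 0 is the
  -- coefficient b_0 of y^{(n+4)}.
  let g : ℕ → ℝ := fun q => ((n : ℝ) + 4 - q) * (n + 3 - q) * (if q = 0 then -1 else b q)
    * r ^ q * p.2 (n + 3 - q)
  have hg : ∑ q ∈ Finset.range (n + 2), g (q + 1)
      = ∑ q ∈ Finset.range (n + 2), g q + g (n + 2) - g 0 := by
    rw [← Finset.sum_range_succ, Finset.sum_range_succ' g]
    ring
  have hd : ∑ q ∈ Finset.range (n + 2), defect n b q * r ^ q * p.2 (n + 3 - q)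
      = ∑ q ∈ Finset.range (n + 2), 2 * (q + 1) * b (q + 1) * r ^ q * p.2 (n + 3 - q)
        + ∑ q ∈ Finset.range (n + 2), g (q + 1) + g 0 := by
    -- Lowering y'' in the last monomial gives r^{n+2} y' = r^{n+1} y'', which merges with the term
    -- q = n + 1. This is the source of the exceptional summand in `defect`.
    have h1 : ∑ q ∈ Finset.range (n + 2),
        (if q = n + 1 then 2 * b (n + 2) else 0) * r ^ q * p.2 (n + 3 - q) = g (n + 2) := by
      rw [Finset.sum_eq_single (n + 1) (fun q _ hq => by simp [hq]) (by simp)]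
      simp only [g, if_true, show n + 3 - (n + 1) = 2 by omega, show n + 3 - (n + 2) = 1 by omega,
        hr2, if_neg (Nat.succ_ne_zero (n + 1))]
      push_cast
      ring
    rw [hg, ← h1]
    simp only [defect, add_mul, Finset.sum_add_distrib, g]
    ring
  have h0 : g 0 = -((n : ℝ) + 4) * (n + 3) * p.2 (n + 3) := by
    simp [g]
    ring
  rw [hd, h0, show n + 4 - 1 = n + 3 by omega]
  have key : ∀ q ∈ Finset.range (n + 2), b (q + 1) *
      ((q + 1) * r ^ q * (-((2 : ℕ) * (m * p.2 2) + γ * ((2 : ℕ) * ((2 : ℕ) - 1)) * p.2 (2 - 1))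
          / p.2 1 - p.2 2 * -((1 : ℕ) * (m * p.2 1) + γ * ((1 : ℕ) * ((1 : ℕ) - 1)) * p.2 (1 - 1))
          / p.2 1 ^ 2) * p.2 (n + 3 - q)
        + r ^ (q + 1) * -((n + 3 - q : ℕ) * (m * p.2 (n + 3 - q))
          + γ * ((n + 3 - q : ℕ) * ((n + 3 - q : ℕ) - 1)) * p.2 (n + 3 - q - 1)))
      = -(n + 4) * m * (b (q + 1) * r ^ (q + 1) * p.2 (n + 3 - q))
        - γ * (2 * (q + 1) * b (q + 1) * r ^ q * p.2 (n + 3 - q)) - γ * g (q + 1) := by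
    intro q hq
    obtain ⟨l, hl⟩ : ∃ l, n + 3 = q + (l + 1) := ⟨n + 2 - q, by have := Finset.mem_range.1 hq; omega⟩
    have hl' : (n : ℝ) = q + l - 2 := by
      have : ((n + 3 : ℕ) : ℝ) = ((q + (l + 1) : ℕ) : ℝ) := by rw [hl]
      push_cast at this
      linarith
    simp only [g, hr2, show n + 3 - q = l + 1 by omega, show n + 3 - (q + 1) = l by omega,
      Nat.add_sub_cancel, if_neg (Nat.succ_ne_zero q), hl']
    push_cast
    field_simp
    ring
  rw [Finset.sum_congr rfl key]
  simp only [Finset.sum_sub_distrib, ← Finset.mul_sum]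
  push_cast
  ring

theorem isPointSymmetry_baseLHS (n : ℕ) {b : ℕ → ℝ} (h : ∀ q < n + 2, defect n b q = 0)
    (α β γ : ℝ) (U : Set (ℝ × ℝ)) :
    IsPointSymmetry U (baseLHS (n + 4) b) (quadField α β γ) := by
  intro p _ h1 h0
  rw [prolong_baseLHS n b h1, baseDir_quadField n b α β γ h1, h0, Finset.sum_eq_zero]
  · ring
  · intro q hq
    rw [h q (Finset.mem_range.1 hq)]
    ring

/-- The added term has weight -(n+4) like the base part, and its ξ'' contributions cancel because 2
y' y''' - 3 (y'')^2 is of Schwarzian type. The whole left side is thus multiplied by -(n+4) ξ'. -/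
theorem isPointSymmetry_modifiedLHS (n : ℕ) {b : ℕ → ℝ} (h : ∀ q < n + 2, defect n b q = 0)
    (α β γ : ℝ) (U : Set (ℝ × ℝ)) :
    IsPointSymmetry U (modifiedLHS (n + 4) b) (quadField α β γ) := by
  intro p _ h1 h0
  rw [modifiedLHS_eq n b h1] at h0
  rw [prolong_modifiedLHS n b h1, modifiedDir, baseDir_quadField n b α β γ h1,
    eq_neg_of_add_eq_zero_left h0, Finset.sum_eq_zero]
  · simp only [prolongCoeff_quadField]
    cases n with
    | zero => norm_num; ring
    | succ n =>
      simp only [Nat.add_sub_cancel, show 2 - 1 = 1 by rfl, show 3 - 1 = 2 by rfl]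
      push_cast
      ring
  · intro q hq
    rw [h q (Finset.mem_range.1 hq)]
    ring

theorem isSl2Invariant_baseLHS (n : ℕ) {b : ℕ → ℝ} (h : ∀ q < n + 2, defect n b q = 0) :
    IsSl2Invariant (baseLHS (n + 4) b) := by
  refine ⟨?_, ?_, ?_⟩
  · convert isPointSymmetry_baseLHS n h 0 1 0 Set.univ using 2; simp [quadField]
  · convert isPointSymmetry_baseLHS n h 1 0 0 Set.univ using 2; simp [quadField]
  · convert isPointSymmetry_baseLHS n h 0 0 1 Set.univ using 2; simp [quadField]

/-- The defect sum does not involve y^{(n+4)}, so that coordinate can be chosen to satisfy the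
equation while the lower ones stay arbitrary. -/
theorem sum_defect_eq_zero (n : ℕ) {b : ℕ → ℝ} (h : IsSl2Invariant (baseLHS (n + 4) b))
    (f : ℕ → ℝ) (hf : f 1 ≠ 0) :
    ∑ q ∈ Finset.range (n + 2), defect n b q * (f 2 / f 1) ^ q * f (n + 3 - q) = 0 := by
  have hV : (fun z : ℝ × ℝ => (z.1 ^ 2, (0 : ℝ))) = quadField 0 0 1 := by
    funext z; simp [quadField]
  have h3 := h.2.2
  rw [hV] at h3
  set c := ∑ q ∈ Finset.range (n + 2), b (q + 1) * (f 2 / f 1) ^ (q + 1) * f (n + 3 - q)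
  let p : Jet := (0, Function.update f (n + 4) c)
  have hne : ∀ j, j ≠ n + 4 → p.2 j = f j := fun j hj => Function.update_of_ne hj _ _
  have hq : ∀ q, p.2 (n + 3 - q) = f (n + 3 - q) := fun q => hne _ (by omega)
  have hp1 : p.2 1 ≠ 0 := by rwa [hne 1 (by omega)]
  have hp0 : baseLHS (n + 4) b p = 0 := by
    rw [baseLHS_eq n b hp1]
    simp only [hq, hne 1 (by omega), hne 2 (by omega)]
    simp [p, c]
  have := h3 p (Set.mem_univ _) hp1 hp0
  rw [prolong_baseLHS n b hp1, baseDir_quadField n b 0 0 1 hp1, hp0] at this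
  simpa only [hq, hne 1 (by omega), hne 2 (by omega), mul_zero, zero_add, one_mul] using this

theorem defect_eq_zero (n : ℕ) {b : ℕ → ℝ} (h : IsSl2Invariant (baseLHS (n + 4) b)) :
    ∀ q < n + 2, defect n b q = 0 := by
  -- The test jet has y' = y'' = y^{(n+3-s)} = 1 and zeros at the other positions. Since y'' must be
  -- nonzero for r^s to survive, the term q = n + 1 is always present too, so its defect is
  -- eliminated first.
  have key : ∀ s < n + 2, (s = n + 1 ∨ defect n b (n + 1) = 0) → defect n b s = 0 := by
    intro s hs hs'
    have h1 := sum_defect_eq_zero n h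
      (fun j => if j = 1 ∨ j = 2 ∨ j = n + 3 - s then 1 else 0) (by simp)
    rw [Finset.sum_eq_single s] at h1
    · simpa using h1
    · intro q hq hqs
      have hq' := Finset.mem_range.1 hq
      by_cases hqn : q = n + 1
      · rcases hs' with rfl | h0
        · exact absurd hqn hqs
        · rw [hqn, h0]; ring
      · rw [if_neg (c := n + 3 - q = 1 ∨ _) (by omega), mul_zero]
    · intro hs0
      exact absurd (Finset.mem_range.2 hs) hs0
  intro q hq
  exact key q hq (Or.inr (key (n + 1) (by omega) (Or.inl rfl)))

/-- The coefficients of the invariant equation, except for the last one. -/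
def innerCoeff (n : ℕ) : ℕ → ℝ
  | 0 => -1
  | q + 1 => -((n : ℝ) + 4 - q) * (n + 3 - q) * innerCoeff n q / (2 * (q + 1))

/-- The coefficients of the invariant equation of order `n + 4`. -/
def sl2Coeff (n q : ℕ) : ℝ :=
  if q = n + 2 then -3 * innerCoeff n (n + 1) / (n + 3) else innerCoeff n q

theorem defect_sl2Coeff (n : ℕ) : ∀ q < n + 2, defect n (sl2Coeff n) q = 0 := by
  intro q hq
  have h1 : (if q = 0 then -1 else sl2Coeff n q) = innerCoeff n q := by
    split_ifs with h0
    · rw [h0]; rfl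
    · rw [sl2Coeff, if_neg (by omega)]
  rw [defect, h1]
  -- At q = n + 1 two terms carry b_{n+2}, with total factor 2(n+2) + 2 = 2(n+3); hence the
  -- different last coefficient.
  by_cases hn : q = n + 1
  · subst hn
    have h2 : sl2Coeff n (n + 2) = -3 * innerCoeff n (n + 1) / (n + 3) := if_pos rfl
    rw [if_pos rfl, show n + 1 + 1 = n + 2 from rfl, h2]
    have : (n : ℝ) + 3 ≠ 0 := by positivity
    push_cast
    field_simp
    ring
  · rw [if_neg hn, sl2Coeff, if_neg (by omega), innerCoeff]
    have : (q : ℝ) + 1 ≠ 0 := by positivity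
    field_simp
    ring

/-- Each equation determines the next coefficient from the previous one, since its factor 2(q+1), or
2(n+3) at the end, is positive. -/
theorem eq_of_defect_eq_zero (n : ℕ) {a b : ℕ → ℝ} (ha : ∀ q < n + 2, defect n a q = 0)
    (hb : ∀ q < n + 2, defect n b q = 0) : ∀ q < n + 2, b (q + 1) = a (q + 1) := by
  intro q
  induction q with
  | zero =>
    intro hq
    have h1 := ha 0 hq
    have h2 := hb 0 hq
    simp [defect] at h1 h2
    linarith
  | succ q ih =>
    intro hq
    have h1 := ha (q + 1) hq
    have h2 := hb (q + 1) hq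
    have hpos : (0 : ℝ) < q + 2 := by positivity
    simp only [defect, if_neg (Nat.succ_ne_zero q), ih (by omega)] at h1 h2
    by_cases hn : q + 1 = n + 1
    · obtain rfl : q = n := by omega
      simp only [if_true] at h1 h2
      push_cast at h1 h2
      have : (2 * (q : ℝ) + 6) * (b (q + 2) - a (q + 2)) = 0 := by linear_combination h2 - h1
      rcases mul_eq_zero.1 this with h | h
      · linarith
      · exact sub_eq_zero.1 h
    · simp only [if_neg hn] at h1 h2
      push_cast at h1 h2
      have : (2 * (q : ℝ) + 4) * (b (q + 1 + 1) - a (q + 1 + 1)) = 0 := by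
        linear_combination h2 - h1
      rcases mul_eq_zero.1 this with h | h
      · linarith
      · exact sub_eq_zero.1 h

/-! ### Order and nonlinearity -/

theorem hasOrder_modifiedLHS (n : ℕ) (a : ℕ → ℝ) : HasOrder (n + 4) (modifiedLHS (n + 4) a) := by
  constructor
  · intro p q hp hx h
    have hq : q.2 1 ≠ 0 := by rwa [← h 1 (by omega)]
    rw [modifiedLHS_eq n a hp, modifiedLHS_eq n a hq, baseLHS_eq n a hp, baseLHS_eq n a hq,
      h 0 (by omega), h 1 (by omega), h 2 (by omega), h 3 (by omega), h (n + 4) le_rfl]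
    congr 2
    exact Finset.sum_congr rfl fun i _ => by rw [h (n + 3 - i) (by omega)]
  · refine ⟨(0, fun j => if j = 1 then 1 else 0),
      (0, fun j => if j = 1 ∨ j = n + 4 then 1 else 0), by simp, by simp, rfl, ?_, ?_⟩
    · intro j hj
      simp [hj]
    · rw [modifiedLHS_eq n a (by simp), modifiedLHS_eq n a (by simp), baseLHS_eq n a (by simp),
        baseLHS_eq n a (by simp)]
      simp

/-- The jet over `x` with coordinates `y = u`, `y' = v`, `y^{(n+4)} = w`, all others zero. -/
def lineJet (n : ℕ) (x u v w : ℝ) : Jet :=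
  (x, fun j => if j = 0 then u else if j = 1 then v else if j = n + 4 then w else 0)

theorem modifiedLHS_lineJet (n : ℕ) (a : ℕ → ℝ) (x u w : ℝ) {v : ℝ} (hv : v ≠ 0) :
    modifiedLHS (n + 4) a (lineJet n x u v w) = w + u * v ^ (n + 4) := by
  have hv' : (lineJet n x u v w).2 1 ≠ 0 := by simpa [lineJet] using hv
  rw [modifiedLHS_eq n a hv', baseLHS_eq n a hv']
  simp [lineJet]

theorem not_isLinearODE_modifiedLHS (n : ℕ) (a : ℕ → ℝ) :
    ¬ IsLinearODE (n + 4) (modifiedLHS (n + 4) a) := by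
  rintro ⟨b, c, h⟩
  have key : ∀ u v w : ℝ, v ≠ 0 →
      (w + u * v ^ (n + 4) = 0 ↔ b 0 + (c 0 0 * u + c 1 0 * v + c (n + 4) 0 * w) = 0) := by
    intro u v w hv
    have h1 := h (lineJet n 0 u v w) (by simpa [lineJet] using hv)
    rw [modifiedLHS_lineJet n a 0 u w hv] at h1
    rw [h1]
    have : ∑ j ∈ Finset.range (n + 4 + 1), c j 0 * (lineJet n 0 u v w).2 j
        = c 0 0 * u + c 1 0 * v + c (n + 4) 0 * w := by
      rw [Finset.sum_range_succ, Finset.sum_range_succ', Finset.sum_range_succ',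
        Finset.sum_eq_zero]
      · simp [lineJet]
        ring
      · intro j hj
        have := Finset.mem_range.1 hj
        simp only [lineJet]
        rw [if_neg (by omega), if_neg (by omega), if_neg (by omega), mul_zero]
    rw [show (lineJet n 0 u v w).1 = 0 from rfl, this]
  -- On these jets the equation reads w + u v^k = 0. Two zeros with u = w = 0 force b(0) = c_1(0) =
  -- 0; two with u = 1 force c_k(0) = 0. Then u = 0, v = w = 1 solves the linear equation but not
  -- the given one.
  have e1 := (key 0 1 0 one_ne_zero).1 (by ring)
  have e2 := (key 0 2 0 two_ne_zero).1 (by ring)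
  have e3 := (key 1 1 (-1) one_ne_zero).1 (by ring)
  have e4 := (key 1 2 (-2 ^ (n + 4)) two_ne_zero).1 (by ring)
  have h1 : c 1 0 = 0 := by linarith
  have h0 : b 0 = 0 := by linarith
  have hpow : (1 : ℝ) < 2 ^ (n + 4) := one_lt_pow₀ (by norm_num) (by omega)
  have hk : c (n + 4) 0 * (2 ^ (n + 4) - 1) = 0 := by linear_combination e3 - e4 + h1
  have hk' : c (n + 4) 0 = 0 := by
    rcases mul_eq_zero.1 hk with h | h
    · exact h
    · linarith
  have := (key 0 1 1 one_ne_zero).2 (by rw [h0, h1, hk']; ring)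
  norm_num at this

/-! ### The determining equations -/

/-- The jet over `(x, y)` with `y' = u`, `y'' = w`, `y^{(n+3)} = s`, `y^{(n+4)} = t`, and all
other coordinates zero. -/
def topJet (n : ℕ) (x y u w s t : ℝ) : Jet :=
  (x, fun j => if j = 0 then y else if j = 1 then u else if j = 2 then w else
    if j = n + 3 then s else if j = n + 4 then t else 0)

theorem topJet_low (n : ℕ) (x y u w s t : ℝ) {j : ℕ} (hj : j ≤ n + 2) :
    (topJet n x y u w s t).2 j = (topJet n x y u w 0 0).2 j := by
  simp only [topJet, if_neg (show j ≠ n + 3 by omega), if_neg (show j ≠ n + 4 by omega)]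

theorem topJet_sub (n : ℕ) (x y u w s t : ℝ) : (topJet n x y u w s t).2 (n + 3) = s := by
  simp [topJet]

theorem topJet_top (n : ℕ) (x y u w s t : ℝ) : (topJet n x y u w s t).2 (n + 4) = t := by
  simp [topJet]

theorem topJet_three (n : ℕ) (x y u w s t : ℝ) :
    (topJet n x y u w s t).2 3 = if n = 0 then s else 0 := by
  by_cases h : n = 0
  · simp [topJet, h]
  · simp [topJet, h, eq_comm]

section

variable {U : Set (ℝ × ℝ)} {X Y : ℝ × ℝ → ℝ}

local notation "V" => (fun z => (X z, Y z) : ℝ × ℝ → ℝ × ℝ)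

/-- The coefficient of `y^{(k-1)}` in the determining equation. -/
theorem determining_sub (hU : IsOpen U) (hX : ContDiffOn ℝ ∞ X U) (hY : ContDiffOn ℝ ∞ Y U)
    (n : ℕ) (a : ℕ → ℝ) (hV : IsPointSymmetry U (modifiedLHS (n + 4) a) V) {x y u : ℝ}
    (hxy : (x, y) ∈ U) (hu : u ≠ 0) (w : ℝ) :
    subCoeff X Y (n + 4) (topJet n x y u w 0 0)
      - a 1 * (prolongCoeff V 2 (topJet n x y u w 0 0) / u
        - w * prolongCoeff V 1 (topJet n x y u w 0 0) / u ^ 2)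
      - a 1 * (w / u) * baseDeriv X (topJet n x y u w 0 0)
      + (if n = 0 then 2 * (u * baseDeriv X (topJet n x y u w 0 0)
        + prolongCoeff V 1 (topJet n x y u w 0 0)) else 0) = 0 := by
  set q := topJet n x y u w 0 0 with hq
  -- Both remainders have order at most n + 2, so they are independent of s and t. The symmetry
  -- condition becomes affine in s once t is eliminated.
  obtain ⟨R, hR, hRe⟩ := exists_prolongCoeff_eq hU hX hY n
  obtain ⟨S, hS, hSe⟩ := exists_prolongCoeff_eq_top hU hX hY n
  set T := ∑ i ∈ Finset.range (n + 1), a (i + 2) * (w / u) ^ (i + 2) * q.2 (n + 2 - i) with hT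
  let P : ℝ → ℝ → Jet := fun s t => topJet n x y u w s t
  have hmem : ∀ s t, ((P s t).1, (P s t).2 0) ∈ U := fun s t => hxy
  have hne : ∀ s t, (P s t).2 1 ≠ 0 := fun s t => hu
  have hlow : ∀ s t (j : ℕ), j ≤ n + 2 → (P s t).2 j = q.2 j :=
    fun s t j hj => topJet_low n x y u w s t hj
  have vlow : ∀ s t (j : ℕ), j ≤ n + 2 → prolongCoeff V j (P s t) = prolongCoeff V j q :=
    fun s t j hj => prolongCoeff_congr_jet hU hX hY j (hmem s t) rfl
      fun i hi => hlow s t i (hi.trans hj)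
  have hΔ : ∀ s t, modifiedLHS (n + 4) a (P s t) = t - (a 1 * (w / u) * s + T)
      + (y * u ^ (n + 4) + (2 * u * (if n = 0 then s else 0) - 3 * w ^ 2) * u ^ n) := by
    intro s t
    rw [modifiedLHS_eq n a (hne s t), baseLHS_eq n a (hne s t), Finset.sum_range_succ',
      topJet_top, topJet_three]
    have hs : ∑ i ∈ Finset.range (n + 1), a (i + 1 + 1)
        * ((P s t).2 2 / (P s t).2 1) ^ (i + 1 + 1) * (P s t).2 (n + 3 - (i + 1)) = T :=
      Finset.sum_congr rfl fun i _ => by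
        rw [show n + 3 - (i + 1) = n + 2 - i by omega, hlow s t (n + 2 - i) (by omega)]
        rfl
    rw [hs, show n + 3 - 0 = n + 3 from rfl, topJet_sub, zero_add, pow_one, add_comm T]
    rfl
  set W := ∑ i ∈ Finset.range (n + 1), a (i + 2) * ((i + 2) * (w / u) ^ (i + 1)
    * (prolongCoeff V 2 q / u - w * prolongCoeff V 1 q / u ^ 2) * q.2 (n + 2 - i)
      + (w / u) ^ (i + 2) * prolongCoeff V (n + 2 - i) q) with hW
  have hD : ∀ s t, modifiedDir n a (P s t) (fun j => prolongCoeff V j (P s t))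
      = (topCoeff X Y (n + 4) q * t + subCoeff X Y (n + 4) q * s + R q)
        - (W + a 1 * ((prolongCoeff V 2 q / u - w * prolongCoeff V 1 q / u ^ 2) * s
          + (w / u) * (topCoeff X Y (n + 3) q * s + S q)))
        + (prolongCoeff V 0 q * u ^ (n + 4) + y * ((n + 4) * u ^ (n + 3) * prolongCoeff V 1 q)
          + ((2 * prolongCoeff V 1 q * (if n = 0 then s else 0)
              + 2 * u * prolongCoeff V 3 (P s t) - 6 * w * prolongCoeff V 2 q) * u ^ n
            + (2 * u * (if n = 0 then s else 0) - 3 * w ^ 2)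
              * (n * u ^ (n - 1) * prolongCoeff V 1 q))) := by
    intro s t
    have e4 : prolongCoeff V (n + 4) (P s t)
        = topCoeff X Y (n + 4) q * t + subCoeff X Y (n + 4) q * s + R q := by
      rw [hRe _ (hmem s t), hR.congr_jet (p := P s t) (q := q) rfl (hlow s t), topJet_sub,
        topJet_top]
      rfl
    have e3 : prolongCoeff V (n + 3) (P s t) = topCoeff X Y (n + 3) q * s + S q := by
      rw [hSe _ (hmem s t), hS.congr_jet (p := P s t) (q := q) rfl (hlow s t), topJet_sub]
      rfl
    have hs : ∑ i ∈ Finset.range (n + 1), a (i + 1 + 1) * (((i + 1 : ℕ) + 1)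
        * ((P s t).2 2 / (P s t).2 1) ^ (i + 1)
        * (prolongCoeff V 2 q / (P s t).2 1 - (P s t).2 2 * prolongCoeff V 1 q / (P s t).2 1 ^ 2)
        * (P s t).2 (n + 3 - (i + 1))
        + ((P s t).2 2 / (P s t).2 1) ^ (i + 1 + 1)
          * prolongCoeff V (n + 3 - (i + 1)) (P s t)) = W :=
      Finset.sum_congr rfl fun i _ => by
        rw [show n + 3 - (i + 1) = n + 2 - i by omega, hlow s t (n + 2 - i) (by omega),
          vlow s t (n + 2 - i) (by omega)]
        push_cast
        rw [add_assoc (i : ℝ) 1 1, one_add_one_eq_two]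
        rfl
    rw [modifiedDir, baseDir, Finset.sum_range_succ', vlow s t 0 (by omega),
      vlow s t 1 (by omega), vlow s t 2 (by omega), hs, show n + 3 - 0 = n + 3 from rfl, e4, e3,
      topJet_sub, topJet_three]
    simp only [Nat.cast_zero, zero_add, pow_zero, pow_one, one_mul]
    rfl
  -- The values of y^{(n+4)} solving the equation for s = 0 and s = 1. The difference of the two
  -- symmetry conditions is the coefficient of s.
  let t₀ := T - (y * u ^ (n + 4) + (-3 * w ^ 2) * u ^ n)
  let t₁ := a 1 * (w / u) - (if n = 0 then 2 * u * u ^ n else 0) + t₀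
  have h0 := hV (P 0 t₀) (hmem _ _) (hne _ _) (by
    rw [hΔ]; simp only [t₀]; split_ifs <;> ring)
  have h1 := hV (P 1 t₁) (hmem _ _) (hne _ _) (by
    rw [hΔ]; simp only [t₀, t₁]; split_ifs <;> ring)
  rw [prolong_modifiedLHS n a (hne _ _), hD] at h0 h1
  have hA := topCoeff_succ (X := X) (Y := Y) (n + 3) q
  rw [show n + 3 + 1 = n + 4 from rfl] at hA
  -- For n = 0 the coordinate y''' is y^{(k-1)} itself, so the Schwarzian term also depends on s.
  by_cases hn : n = 0
  · subst hn
    rw [show prolongCoeff V 3 (P 0 t₀) = _ from hSe _ (hmem _ _),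
      hS.congr_jet (p := P 0 t₀) (q := q) rfl (hlow _ _), topJet_sub] at h0
    rw [show prolongCoeff V 3 (P 1 t₁) = _ from hSe _ (hmem _ _),
      hS.congr_jet (p := P 1 t₁) (q := q) rfl (hlow _ _), topJet_sub,
      show topCoeff X Y (0 + 3) (P 1 t₁) = topCoeff X Y (0 + 3) q from rfl] at h1
    simp only [if_true, t₁, pow_zero, Nat.cast_zero] at h0 h1 ⊢
    rw [hA] at h0 h1
    linear_combination h1 - h0
  · rw [vlow _ _ 3 (by omega)] at h0 h1
    simp only [if_neg hn, t₁] at h0 h1 ⊢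
    rw [hA] at h0 h1
    linear_combination h1 - h0

/-- The part of `determining_sub` linear in w = y'' is, after clearing u^2, -k X_y u^2 + k(k-1)/2
Y_x: the value of a 1 makes all other terms cancel. The exceptional term for k = 4 does not involve
w. -/
theorem py_fst_px_snd_eq_zero (hU : IsOpen U) (hX : ContDiffOn ℝ ∞ X U) (hY : ContDiffOn ℝ ∞ Y U)
    (n : ℕ) {a : ℕ → ℝ} (ha : a 1 = (n + 4) * (n + 3) / 2)
    (hV : IsPointSymmetry U (modifiedLHS (n + 4) a) V) {z : ℝ × ℝ} (hz : z ∈ U) :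
    py X z = 0 ∧ px Y z = 0 := by
  obtain ⟨x, y⟩ := z
  have key : ∀ u : ℝ, u ≠ 0 →
      -(n + 4) * py X (x, y) * u ^ 2 + (n + 4) * (n + 3) / 2 * px Y (x, y) = 0 := by
    intro u hu
    have e : ∀ w : ℝ, _ := fun w => determining_sub hU hX hY n a hV hz hu w
    have e0 := e 0
    have e1 := e 1
    rw [prolongCoeff_one hU hX hY hz, prolongCoeff_two hU hX hY hz] at e0 e1
    simp only [subCoeff, topCoeff, baseDeriv, topJet, ha, if_true, if_neg one_ne_zero,
      if_neg two_ne_zero, if_neg (show (2 : ℕ) ≠ 1 by norm_num)] at e0 e1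
    push_cast at e0 e1
    have e2 := sub_eq_zero.2 (e1.trans e0.symm)
    field_simp at e2
    split_ifs at e2 <;> linear_combination e2 / 2
  -- Two slopes suffice to separate the coefficients of u^2 and 1.
  have k1 := key 1 one_ne_zero
  have k2 := key 2 two_ne_zero
  have hn : (n : ℝ) + 4 ≠ 0 := by positivity
  have hn' : (n : ℝ) + 3 ≠ 0 := by positivity
  have h1 : ((n : ℝ) + 4) * py X (x, y) = 0 := by linear_combination (k1 - k2) / 3
  have h2 : ((n : ℝ) + 4) * ((n + 3) * px Y (x, y)) = 0 := by linear_combination 2 * k1 + 2 * h1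
  refine ⟨?_, ?_⟩
  · simpa [hn] using h1
  · simpa [hn, hn'] using h2

/-- At w = 0 the X_xx terms cancel and -k(k-3)/2 u Y_yy remains, with the additional summand 2 u Y_y
when k = 4. -/
theorem py_py_snd_eq (hU : IsOpen U) (hX : ContDiffOn ℝ ∞ X U) (hY : ContDiffOn ℝ ∞ Y U)
    (n : ℕ) {a : ℕ → ℝ} (ha : a 1 = (n + 4) * (n + 3) / 2)
    (hV : IsPointSymmetry U (modifiedLHS (n + 4) a) V) {z : ℝ × ℝ} (hz : z ∈ U) :
    py (py Y) z = if n = 0 then py Y z else 0 := by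
  have hXy : ∀ z ∈ U, py X z = 0 := fun z hz => (py_fst_px_snd_eq_zero hU hX hY n ha hV hz).1
  have hYx : ∀ z ∈ U, px Y z = 0 := fun z hz => (py_fst_px_snd_eq_zero hU hX hY n ha hV hz).2
  have c1 : px (py X) z = 0 := by rw [(px_py_congr hU hXy hz).1, px_zero]
  have c2 : py (py X) z = 0 := by rw [(px_py_congr hU hXy hz).2, py_zero]
  have c3 : py (px X) z = 0 := py_px_iterate hU hX hXy 1 z hz
  have c4 : px (py Y) z = 0 := px_py_iterate hU hY hYx 1 z hz
  have c5 : px (px Y) z = 0 := by rw [(px_py_congr hU hYx hz).1, px_zero]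
  have c6 : py (px Y) z = 0 := by rw [(px_py_congr hU hYx hz).2, py_zero]
  have c7 := hXy z hz
  have c8 := hYx z hz
  obtain ⟨x, y⟩ := z
  have e := determining_sub hU hX hY n a hV hz one_ne_zero 0
  rw [prolongCoeff_one hU hX hY hz, prolongCoeff_two hU hX hY hz] at e
  simp only [subCoeff, topCoeff, baseDeriv, topJet, ha, if_true, if_neg one_ne_zero,
    if_neg two_ne_zero, if_neg (show (2 : ℕ) ≠ 1 by norm_num), c1, c2, c3, c4, c5, c6, c7, c8] at e
  push_cast at e
  by_cases hn : n = 0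
  · subst hn
    simp only [if_true] at e ⊢
    push_cast at e
    linear_combination -e / 2
  · simp only [if_neg hn] at e ⊢
    have hn1 : (1 : ℝ) ≤ n := by exact_mod_cast Nat.one_le_iff_ne_zero.2 hn
    have : ((n : ℝ) + 4) * ((n + 1) * py (py Y) (x, y)) = 0 := by linear_combination -2 * e
    simpa [show (n : ℝ) + 4 ≠ 0 by positivity, show (n : ℝ) + 1 ≠ 0 by positivity] using this

theorem lineJet_high (n : ℕ) (x y v w : ℝ) {j : ℕ} (h2 : 2 ≤ j) (hj : j ≠ n + 4) :
    (lineJet n x y v w).2 j = 0 := by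
  simp only [lineJet]
  rw [if_neg (by omega), if_neg (by omega), if_neg hj]

theorem modifiedDir_lineJet (n : ℕ) (a : ℕ → ℝ) (x y v w : ℝ) (f : ℕ → ℝ) :
    modifiedDir n a (lineJet n x y v w) f = f (n + 4) + (f 0 * v ^ (n + 4)
      + y * ((n + 4) * v ^ (n + 3) * f 1) + 2 * v * f 3 * v ^ n) := by
  have h1 : (lineJet n x y v w).2 1 = v := rfl
  have h2 : (lineJet n x y v w).2 2 = 0 := lineJet_high n x y v w le_rfl (by omega)
  have h3 : (lineJet n x y v w).2 3 = 0 := lineJet_high n x y v w (by omega) (by omega)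
  rw [modifiedDir, baseDir, Finset.sum_eq_zero, h1, h2, h3]
  · change f (n + 4) - 0 + (f 0 * v ^ (n + 4) + y * ((n + 4) * v ^ (n + 3) * f 1) + _) = _
    ring
  · intro q hq
    have := Finset.mem_range.1 hq
    rw [lineJet_high n x y v w (j := n + 3 - q) (by omega) (by omega), h2]
    simp

/-- With X_y = Y_x = 0, straight-line jets have η^{(j)} = v^j ∂_y^j Y - v ∂_x^j X. The X_x terms
cancel by weight, leaving a polynomial in the slope v. -/
theorem determining_line (hU : IsOpen U) (hX : ContDiffOn ℝ ∞ X U) (hY : ContDiffOn ℝ ∞ Y U)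
    (hXy : ∀ z ∈ U, py X z = 0) (hYx : ∀ z ∈ U, px Y z = 0)
    (n : ℕ) {a : ℕ → ℝ} (hV : IsPointSymmetry U (modifiedLHS (n + 4) a) V) {x y : ℝ}
    (hxy : (x, y) ∈ U) {v : ℝ} (hv : v ≠ 0) :
    v ^ (n + 4) * ((py^[n + 4] Y) (x, y) + Y (x, y) + (n + 3) * y * py Y (x, y)
        + 2 * (py^[3] Y) (x, y))
      + v ^ (n + 2) * (-2 * (px^[3] X) (x, y)) + v * (-(px^[n + 4] X) (x, y)) = 0 := by
  -- The value of y^{(n+4)} that puts the jet on the equation. The true straight-line jet `q`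
  -- differs from `p` only in this coordinate, which enters η^{(n+4)} linearly.
  let w := -(y * v ^ (n + 4))
  let p := lineJet n x y v w
  let q := lineJet n x y v 0
  have hp : (p.1, p.2 0) ∈ U := hxy
  have hq : (q.1, q.2 0) ∈ U := hxy
  have hq2 : ∀ i, 2 ≤ i → q.2 i = 0 := by
    intro i hi
    simp only [q, lineJet]
    rw [if_neg (by omega), if_neg (by omega)]
    simp
  have hpq : ∀ j ≤ n + 3, p.2 j = q.2 j := by
    intro j hj
    simp only [p, q, lineJet, if_neg (show j ≠ n + 4 by omega)]
  have h := hV p hp hv (by rw [modifiedLHS_lineJet n a x y w hv]; ring)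
  rw [prolong_modifiedLHS n a hv, modifiedDir_lineJet] at h
  have hlow : ∀ j ≤ n + 3, prolongCoeff V j p = prolongCoeff V j q := fun j hj =>
    prolongCoeff_congr_jet hU hX hY j hp rfl fun i hi => hpq i (hi.trans hj)
  have htop : prolongCoeff V (n + 4) p
      = topCoeff X Y (n + 4) q * w + prolongCoeff V (n + 4) q := by
    obtain ⟨R, hR, hRe⟩ := exists_prolongCoeff_eq hU hX hY n
    rw [hRe p hp, hRe q hq, hR.congr_jet (p := p) (q := q) rfl fun j hj => hpq j (by omega),
      hpq (n + 3) le_rfl, hq2 (n + 3) (by omega), hq2 (n + 4) (by omega),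
      show topCoeff X Y (n + 4) p = topCoeff X Y (n + 4) q from rfl,
      show p.2 (n + 4) = w by simp [p, lineJet]]
    ring
  have l1 := prolongCoeff_line hU hX hY hXy hYx 0 q hq hq2
  have l3 := prolongCoeff_line hU hX hY hXy hYx 2 q hq hq2
  have lk := prolongCoeff_line hU hX hY hXy hYx (n + 3) q hq hq2
  simp only [zero_add, Function.iterate_one] at l1
  rw [htop, hlow 0 (by omega), hlow 1 (by omega), hlow 3 (by omega), lk, l1, l3] at h
  have e0 : prolongCoeff V 0 q = Y (x, y) := rfl
  rw [e0] at h
  simp only [topCoeff, baseDeriv, w, q, lineJet, if_true, if_neg one_ne_zero,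
    hXy _ hxy] at h
  push_cast at h
  linear_combination h

/-- The slopes 1, 2, 4 eliminate c and then separate a from b, because 2^{n+2} > 2. -/
theorem eq_zero_of_pow_combination (n : ℕ) {a b c : ℝ}
    (h : ∀ v : ℝ, v ≠ 0 → v ^ (n + 4) * a + v ^ (n + 2) * b + v * c = 0) : a = 0 ∧ b = 0 := by
  have h1 := h 1 one_ne_zero
  have h2 := h 2 two_ne_zero
  have h4 := h 4 four_ne_zero
  have hs : (4 : ℝ) ^ (n + 2) = (2 ^ (n + 2)) ^ 2 := by
    rw [← pow_mul, mul_comm, pow_mul]; norm_num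
  rw [show (4 : ℝ) ^ (n + 4) = 16 * 4 ^ (n + 2) by ring, hs] at h4
  rw [show (2 : ℝ) ^ (n + 4) = 4 * 2 ^ (n + 2) by ring] at h2
  have hu : (2 : ℝ) < 2 ^ (n + 2) := by
    have : (1 : ℝ) ≤ 2 ^ n := one_le_pow₀ (by norm_num)
    rw [pow_add]
    linarith
  generalize (2 : ℝ) ^ (n + 2) = u at h2 h4 hu
  simp only [one_pow, one_mul] at h1
  have ha : (12 * u ^ 2 - 6 * u) * a = 0 := by
    linear_combination (h4 - 4 * h1) - (u + 2) * (h2 - 2 * h1)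
  have ha0 : a = 0 := by
    rcases mul_eq_zero.1 ha with h | h
    · nlinarith
    · exact h
  have hb : (u - 2) * b = 0 := by linear_combination h2 - 2 * h1 - (4 * u - 2) * ha0
  refine ⟨ha0, ?_⟩
  rcases mul_eq_zero.1 hb with h | h
  · linarith
  · exact h

theorem py_add_affine_mul (hU : IsOpen U) {f g : ℝ × ℝ → ℝ} (hf : ContDiffOn ℝ ∞ f U)
    (hg : ContDiffOn ℝ ∞ g U) (α β : ℝ) (h : ∀ z ∈ U, f z + (α * z.2 + β) * g z = 0) {z : ℝ × ℝ}
    (hz : z ∈ U) : py f z + α * g z + (α * z.2 + β) * py g z = 0 := by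
  have df := ((hf.contDiffAt (hU.mem_nhds hz)).differentiableAt (by simp)).hasFDerivAt
  have dg := ((hg.contDiffAt (hU.mem_nhds hz)).differentiableAt (by simp)).hasFDerivAt
  have dl : HasFDerivAt (fun z : ℝ × ℝ => α * z.2 + β) (α • ContinuousLinearMap.snd ℝ ℝ ℝ) z :=
    (hasFDerivAt_snd.const_mul α).add_const β
  have h1 : py (fun z => f z + (α * z.2 + β) * g z) z = 0 := by
    rw [(px_py_congr hU h hz).2, py_zero]
  have h2 : HasFDerivAt (fun z => f z + (α * z.2 + β) * g z) _ z := df.add (dl.mul dg)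
  rw [py, h2.fderiv] at h1
  simp only [add_apply, smul_apply,
    ContinuousLinearMap.coe_snd', smul_eq_mul] at h1
  simp only [py]
  linear_combination h1

/-- The v^{n+4} coefficient of the line equation relates Y to its y-derivatives, and `py_py_snd_eq`
reduces all of these to Y_y. The result has the form Y + (αy + β) Y_y = 0, and differentiating in y
kills Y_y and hence Y. -/
theorem determining_solution (hU : IsOpen U) (hX : ContDiffOn ℝ ∞ X U) (hY : ContDiffOn ℝ ∞ Y U)
    (n : ℕ) {a : ℕ → ℝ} (ha : a 1 = (n + 4) * (n + 3) / 2)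
    (hV : IsPointSymmetry U (modifiedLHS (n + 4) a) V) :
    (∀ z ∈ U, py X z = 0) ∧ (∀ z ∈ U, (px^[3] X) z = 0) ∧ ∀ z ∈ U, Y z = 0 := by
  have hXy : ∀ z ∈ U, py X z = 0 := fun z hz => (py_fst_px_snd_eq_zero hU hX hY n ha hV hz).1
  have hYx : ∀ z ∈ U, px Y z = 0 := fun z hz => (py_fst_px_snd_eq_zero hU hX hY n ha hV hz).2
  have hline : ∀ z ∈ U, _ := fun z hz => eq_zero_of_pow_combination n
    fun v hv => determining_line hU hX hY hXy hYx n hV (x := z.1) (y := z.2) hz hv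
  have hsec : ∀ z ∈ U, _ := fun z hz => py_py_snd_eq hU hX hY n ha hV hz
  have hYy := contDiffOn_py hU hY
  refine ⟨hXy, fun z hz => by have := (hline z hz).2; linarith, ?_⟩
  by_cases hn : n = 0
  · subst hn
    simp only [if_true] at hsec
    have h3 : ∀ z ∈ U, (py^[3] Y) z = py Y z := fun z hz =>
      ((px_py_congr hU hsec hz).2).trans (hsec z hz)
    have h4 : ∀ z ∈ U, (py^[4] Y) z = py Y z := fun z hz => by
      rw [Function.iterate_succ_apply', (px_py_congr hU h3 hz).2, hsec z hz]
    have e0 : ∀ z ∈ U, Y z + (3 * z.2 + 3) * py Y z = 0 := fun z hz => by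
      have := (hline z hz).1
      rw [zero_add, h3 (z.1, z.2) hz, h4 (z.1, z.2) hz] at this
      push_cast at this
      linear_combination this
    -- With Y_yy = Y_y one differentiation leaves (3y + 7) Y_y = 0, which says nothing where 3y + 7
    -- = 0. A second one gives (3y + 10) Y_y = 0, and the difference is 3 Y_y = 0.
    have e1 : ∀ z ∈ U, 0 + (3 * z.2 + 7) * py Y z = 0 := fun z hz => by
      have := py_add_affine_mul hU hY hYy 3 3 e0 hz
      rw [hsec z hz] at this
      linear_combination this
    have e2 : ∀ z ∈ U, py Y z = 0 := fun z hz => by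
      have := py_add_affine_mul (f := fun _ => 0) hU contDiffOn_const hYy 3 7 e1 hz
      rw [hsec z hz, py_zero] at this
      linear_combination (this - e1 z hz) / 3
    intro z hz
    have := e0 z hz
    rwa [e2 z hz, mul_zero, add_zero] at this
  · simp only [if_neg hn] at hsec
    have hhigh : ∀ j, ∀ z ∈ U, (py^[j + 2] Y) z = 0 := by
      intro j
      induction j with
      | zero => exact hsec
      | succ j ih =>
        intro z hz
        rw [show j + 1 + 2 = (j + 2) + 1 by ring, Function.iterate_succ_apply',
          (px_py_congr hU ih hz).2, py_zero]
    have e0 : ∀ z ∈ U, Y z + ((n + 3 : ℝ) * z.2 + 0) * py Y z = 0 := fun z hz => by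
      have := (hline z hz).1
      rw [hhigh (n + 2) _ hz, hhigh 1 _ hz] at this
      linear_combination this
    intro z hz
    have e1 := py_add_affine_mul hU hY hYy _ _ e0 hz
    rw [hsec z hz] at e1
    have e2 : ((n : ℝ) + 4) * py Y z = 0 := by linear_combination e1
    have e3 : py Y z = 0 := by simpa [show (n : ℝ) + 4 ≠ 0 by positivity] using e2
    have := e0 z hz
    rwa [e3, mul_zero, add_zero] at this

end

/-! ### Integration of the determining equations -/

theorem px_sub_mul_fst {U : Set (ℝ × ℝ)} (hU : IsOpen U) {f : ℝ × ℝ → ℝ}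
    (hf : ContDiffOn ℝ ∞ f U) (α β γ : ℝ) {z : ℝ × ℝ} (hz : z ∈ U) :
    px (fun z => f z - (α + β * z.1 + γ * z.1 ^ 2)) z = px f z - (β + 2 * γ * z.1) ∧
    py (fun z => f z - (α + β * z.1 + γ * z.1 ^ 2)) z = py f z := by
  have df := (hf.contDiffAt (hU.mem_nhds hz)).differentiableAt (by simp)
  have dq := ((contDiff_quad α β γ).contDiffAt (x := z)).differentiableAt (by simp)
  -- Jets of slope 0 and 1 recover both partial derivatives of the quadratic from its total
  -- derivative.
  have h : ∀ v, baseDeriv (fun z => α + β * z.1 + γ * z.1 ^ 2) (z.1, fun j => if j = 0 then z.2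
      else v) = β + 2 * γ * z.1 := fun v => baseDeriv_quad α β γ _
  have h0 := h 0
  have h1 := h 1
  simp only [baseDeriv, if_true, if_neg one_ne_zero] at h0 h1
  simp only [px, py, fderiv_fun_sub df dq, sub_apply] at h0 h1 ⊢
  constructor
  · linear_combination -h0
  · linear_combination h0 - h1

/-- Integrating three times, each step subtracts a polynomial in x and uses that vanishing gradient
on a connected open set means constant. Vertical slices of `U` may be disconnected, so X_y = 0 alone
would not make X a function of x. -/
theorem exists_quad {U : Set (ℝ × ℝ)} (hU : IsOpen U) (hc : IsPreconnected U) {X : ℝ × ℝ → ℝ}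
    (hX : ContDiffOn ℝ ∞ X U) (hy : ∀ z ∈ U, py X z = 0) (hx : ∀ z ∈ U, (px^[3] X) z = 0) :
    ∃ α β γ : ℝ, ∀ z ∈ U, X z = α + β * z.1 + γ * z.1 ^ 2 := by
  have q : ∀ α β γ : ℝ, ContDiffOn ℝ ∞ (fun z : ℝ × ℝ => α + β * z.1 + γ * z.1 ^ 2) U :=
    fun α β γ => (contDiff_quad α β γ).contDiffOn
  have hX1 := contDiffOn_px hU hX
  have hX2 := contDiffOn_px hU hX1
  have y1 := py_px_iterate hU hX hy 1
  have y2 := py_px_iterate hU hX hy 2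
  obtain ⟨c, h2⟩ := exists_const_of_px_py hU hc hX2 hx y2
  obtain ⟨β, h1⟩ := exists_const_of_px_py hU hc (hX1.sub (q 0 c 0))
    (fun z hz => by
      rw [(px_sub_mul_fst hU hX1 0 c 0 hz).1, h2 z hz]; ring)
    (fun z hz => by rw [(px_sub_mul_fst hU hX1 0 c 0 hz).2]; exact y1 z hz)
  obtain ⟨α, h0⟩ := exists_const_of_px_py hU hc (hX.sub (q 0 β (c / 2)))
    (fun z hz => by
      rw [(px_sub_mul_fst hU hX 0 β (c / 2) hz).1]
      have := h1 z hz
      linear_combination this)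
    (fun z hz => by rw [(px_sub_mul_fst hU hX 0 β (c / 2) hz).2]; exact hy z hz)
  exact ⟨α, β, c / 2, fun z hz => by have := h0 z hz; linear_combination this⟩

/-! ### The symmetry algebra -/

section

variable (U : TopologicalSpace.Opens (ℝ × ℝ))

/-- The restriction of `(α + β x + γ x²) ∂_x` to `U`. -/
def quadVF (α β γ : ℝ) : SmoothVF U :=
  ⟨(U : Set (ℝ × ℝ)).indicator (quadField α β γ), by
    constructor
    · refine ContDiffOn.congr (f := quadField α β γ) ?_ fun z hz => Set.indicator_of_mem hz _
      exact ((contDiff_quad α β γ).prodMk contDiff_const).contDiffOn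
    · exact fun p hp => Set.indicator_of_notMem hp _⟩

variable {U}

theorem quadVF_apply (α β γ : ℝ) {z : ℝ × ℝ} (hz : z ∈ U) :
    (quadVF U α β γ).1 z = quadField α β γ z := Set.indicator_of_mem (s := (U : Set (ℝ × ℝ))) hz _

theorem fderiv_quadField (α β γ : ℝ) (z w : ℝ × ℝ) :
    fderiv ℝ (quadField α β γ) z w = ((β + 2 * γ * z.1) * w.1, 0) := by
  have d := ((contDiff_quad α β γ).contDiffAt (x := z)).differentiableAt (by simp)
  have h : HasFDerivAt (quadField α β γ) _ z := d.hasFDerivAt.prodMk (hasFDerivAt_const (0 : ℝ) z)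
  have h' : ∀ v, baseDeriv (fun z => α + β * z.1 + γ * z.1 ^ 2) (z.1, fun j => if j = 0 then z.2
      else v) = β + 2 * γ * z.1 := fun v => baseDeriv_quad α β γ _
  have h0 := h' 0
  have h1 := h' 1
  simp only [baseDeriv, if_true, if_neg one_ne_zero] at h0 h1
  rw [h.fderiv]
  refine Prod.ext ?_ rfl
  change fderiv ℝ (fun z : ℝ × ℝ => α + β * z.1 + γ * z.1 ^ 2) z (w.1, w.2) = _
  rw [fderiv_apply_eq]
  linear_combination w.1 * h0 + w.2 * (h1 - h0)

theorem mem_sl_fin_two {C : Matrix (Fin 2) (Fin 2) ℝ} :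
    C ∈ LieAlgebra.SpecialLinear.sl (Fin 2) ℝ ↔ C 0 0 + C 1 1 = 0 := by
  rw [← Matrix.trace_fin_two]
  exact LinearMap.mem_ker

theorem lie_quadVF (α β γ α' β' γ' : ℝ) :
    ⁅quadVF U α β γ, quadVF U α' β' γ'⁆
      = quadVF U (α * β' - α' * β) (2 * (α * γ' - α' * γ)) (β * γ' - β' * γ) := by
  refine SmoothVF.ext_on fun z hz => ?_
  have ev : ∀ a b c : ℝ, (quadVF U a b c).1 =ᶠ[nhds z] quadField a b c := fun a b c => by
    filter_upwards [U.isOpen.mem_nhds hz] with w hw using quadVF_apply a b c hw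
  rw [SmoothVF.bracket_apply _ _ hz, (ev _ _ _).lieBracket_vectorField_eq (ev _ _ _),
    quadVF_apply _ _ _ hz, VectorField.lieBracket, fderiv_quadField, fderiv_quadField]
  simp only [quadField]
  refine Prod.ext ?_ (by simp)
  simp only [Prod.fst_sub]
  ring

theorem quadVF_eq_zero (hU : (U : Set (ℝ × ℝ)).Nonempty) {α β γ : ℝ}
    (h : quadVF U α β γ = 0) : α = 0 ∧ β = 0 ∧ γ = 0 := by
  obtain ⟨⟨x, y⟩, hz⟩ := hU
  obtain ⟨δ, hδ, hball⟩ := Metric.isOpen_iff.1 U.isOpen _ hz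
  have key : ∀ t : ℝ, |t| < δ → α + β * (x + t) + γ * (x + t) ^ 2 = 0 := by
    intro t ht
    have hm : (x + t, y) ∈ U := hball (by simp [Metric.mem_ball, Prod.dist_eq, ht])
    have h1 := quadVF_apply α β γ hm
    rw [h] at h1
    exact (congrArg Prod.fst h1).symm
  have h0 := key 0 (by simpa using hδ)
  -- Second and first differences at x and x ± δ/2 isolate γ and β.
  have h1 := key (δ / 2) (by rw [abs_of_pos (by positivity)]; linarith)
  have h2 := key (-(δ / 2)) (by rw [abs_neg, abs_of_pos (by positivity)]; linarith)
  have hg : δ ^ 2 * γ = 0 := by linear_combination 2 * (h1 + h2 - 2 * h0)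
  have hγ : γ = 0 := by simpa [hδ.ne'] using hg
  subst hγ
  have hb : δ * β = 0 := by linear_combination h1 - h2
  have hβ : β = 0 := by simpa [hδ.ne'] using hb
  subst hβ
  exact ⟨by linear_combination h0, rfl, rfl⟩

variable (U) in
/-- The realization of `sl(2, ℝ)` by the vector fields `(α + β x + γ x²) ∂_x` on `U`. -/
def sl2Hom : LieAlgebra.SpecialLinear.sl (Fin 2) ℝ →ₗ⁅ℝ⁆ SmoothVF U where
  -- E_01, diag(1,-1) and E_10 go to ∂_x, -2x∂_x and -x²∂_x; the signs make brackets match rather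
  -- than reverse.
  toFun A := quadVF U (A.1 0 1) (-2 * A.1 0 0) (-A.1 1 0)
  map_add' A B := by
    refine SmoothVF.ext_on fun z hz => ?_
    change _ = (quadVF U _ _ _).1 z + (quadVF U _ _ _).1 z
    rw [quadVF_apply _ _ _ hz, quadVF_apply _ _ _ hz, quadVF_apply _ _ _ hz]
    refine Prod.ext ?_ (by simp [quadField])
    simp [quadField]
    ring
  map_smul' c A := by
    refine SmoothVF.ext_on fun z hz => ?_
    change _ = c • (quadVF U _ _ _).1 z
    rw [quadVF_apply _ _ _ hz, quadVF_apply _ _ _ hz]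
    refine Prod.ext ?_ (by simp [quadField])
    simp [quadField]
    ring
  map_lie' := by
    intro A B
    have tr : ∀ C : LieAlgebra.SpecialLinear.sl (Fin 2) ℝ, C.1 1 1 = -C.1 0 0 := fun C => by
      have := mem_sl_fin_two.1 C.2
      linarith
    change _ = ⁅quadVF U _ _ _, quadVF U _ _ _⁆
    rw [lie_quadVF]
    have e : (⁅A, B⁆ : LieAlgebra.SpecialLinear.sl (Fin 2) ℝ).1 = A.1 * B.1 - B.1 * A.1 := rfl
    simp only [e, Matrix.sub_apply, Matrix.mul_apply, Fin.sum_univ_two, tr]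
    congr 1 <;> ring

theorem sl2Hom_injective (hU : (U : Set (ℝ × ℝ)).Nonempty) : Function.Injective (sl2Hom U) := by
  refine (injective_iff_map_eq_zero (sl2Hom U)).2 fun A hA => ?_
  obtain ⟨h1, h2, h3⟩ := quadVF_eq_zero hU hA
  have tr := mem_sl_fin_two.1 A.2
  have h0 : A.1 0 0 = 0 := by linarith
  refine Subtype.ext (Matrix.ext fun i j => ?_)
  change A.1 i j = 0
  fin_cases i <;> fin_cases j
  · exact h0
  · exact h1
  · simpa using h3
  · change A.1 1 1 = 0
    linarith

theorem quadVF_mem_range (α β γ : ℝ) : quadVF U α β γ ∈ (sl2Hom U).range := by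
  refine (LieHom.mem_range _ _).2 ⟨⟨!![-β / 2, α; -γ, β / 2], ?_⟩, ?_⟩
  · rw [mem_sl_fin_two]
    simp
    ring
  · change quadVF U _ _ _ = _
    congr 1 <;> simp
    ring

theorem IsPointSymmetry.congr {Δ : Jet → ℝ} {V W : ℝ × ℝ → ℝ × ℝ}
    (h : ∀ z ∈ U, V z = W z) (hV : IsPointSymmetry U Δ V) : IsPointSymmetry U Δ W := by
  intro p hp h1 h0
  rw [← hV p hp h1 h0, prolong, prolong, h _ hp]
  congr 2
  funext j
  exact (prolongCoeff_congr U.isOpen h j p hp).symm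

theorem isFullSymmetryAlgebra_range (hU : IsPreconnected (U : Set (ℝ × ℝ))) (n : ℕ)
    {a : ℕ → ℝ} (ha : ∀ q < n + 2, defect n a q = 0) :
    IsFullSymmetryAlgebra U (modifiedLHS (n + 4) a) (sl2Hom U).range := by
  intro V
  constructor
  · intro hV
    obtain ⟨A, rfl⟩ := (LieHom.mem_range _ _).1 hV
    exact (isPointSymmetry_modifiedLHS n ha _ _ _ U).congr
      fun z hz => (quadVF_apply _ _ _ hz).symm
  · intro hV
    have hX : ContDiffOn ℝ ∞ (fun z => (V.1 z).1) U := V.2.1.fst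
    have hY : ContDiffOn ℝ ∞ (fun z => (V.1 z).2) U := V.2.1.snd
    -- The defect at q = 0 determines a 1, the only coefficient that the determining equations use.
    have ha1 : a 1 = (n + 4) * (n + 3) / 2 := by
      have := ha 0 (by omega)
      simp [defect] at this
      linarith
    obtain ⟨h1, h2, h3⟩ := determining_solution U.isOpen hX hY n ha1 hV
    obtain ⟨α, β, γ, h⟩ := exists_quad U.isOpen hU hX h1 h2
    have : V = quadVF U α β γ := SmoothVF.ext_on fun z hz => by
      rw [quadVF_apply _ _ _ hz]
      exact Prod.ext (h z hz) (h3 z hz)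
    rw [this]
    exact quadVF_mem_range α β γ

end

end PointSymmetry

end

theorem mainTheorem3 (k : ℕ) (hk : 4 ≤ k) :
    ∃ a : ℕ → ℝ,
      PointSymmetry.IsSl2Invariant (PointSymmetry.baseLHS k a) ∧
      (∀ b : ℕ → ℝ, PointSymmetry.IsSl2Invariant (PointSymmetry.baseLHS k b) →
        ∀ q ∈ Finset.Icc 1 (k - 2), b q = a q) ∧
      PointSymmetry.HasOrder k (PointSymmetry.modifiedLHS k a) ∧
      ¬ PointSymmetry.IsLinearODE k (PointSymmetry.modifiedLHS k a) ∧
      ∀ U : TopologicalSpace.Opens (ℝ × ℝ), IsConnected (U : Set (ℝ × ℝ)) →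
        ∃ L : LieSubalgebra ℝ (PointSymmetry.SmoothVF U),
          PointSymmetry.IsFullSymmetryAlgebra U (PointSymmetry.modifiedLHS k a) L ∧
          Nonempty (L ≃ₗ⁅ℝ⁆ LieAlgebra.SpecialLinear.sl (Fin 2) ℝ) := by
  obtain ⟨n, rfl⟩ : ∃ n, k = n + 4 := ⟨k - 4, by omega⟩
  have ha := PointSymmetry.defect_sl2Coeff n
  refine ⟨PointSymmetry.sl2Coeff n, PointSymmetry.isSl2Invariant_baseLHS n ha, ?_,
    PointSymmetry.hasOrder_modifiedLHS n _, PointSymmetry.not_isLinearODE_modifiedLHS n _, ?_⟩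
  · intro b hb q hq
    obtain ⟨h1, h2⟩ := Finset.mem_Icc.1 hq
    obtain ⟨i, rfl⟩ : ∃ i, q = i + 1 := ⟨q - 1, by omega⟩
    exact PointSymmetry.eq_of_defect_eq_zero n ha (PointSymmetry.defect_eq_zero n hb) i (by omega)
  · intro U hU
    -- Preconnectedness serves the integration of X; nonemptiness makes the realization faithful.
    exact ⟨_, PointSymmetry.isFullSymmetryAlgebra_range hU.isPreconnected n ha,
      ⟨(LieEquiv.ofInjective _ (PointSymmetry.sl2Hom_injective hU.nonempty)).symm⟩⟩
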